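/- Let $\beta>1$ and let $a_\beta:\mathbb{R}^2\to\{1,\beta\}$ be the chessboard index: $a_\beta=\beta$ on the open unit squares $(p,p+1)\times(q,q+1)$ with $p,q\in\mathbb{Z}$, $p+q$ odd, and $a_\beta=1$ elsewhere. The optical length of an absolutely continuous curve $u:[0,1]\to\mathbb{R}^2$ is $\int_0^1 a_\beta(u(t))\,|u'(t)|\,dt$, and a geodesic from $P$ to $Q$ is an absolutely continuous curve from $P$ to $Q$ of minimal optical length. The light diagonals are the lines $D_k=\{y=x-2k\}$, $k\in\mathbb{Z}$, and the light vertices are the points with integer coordinates on light diagonals. For $p>0$, $q\ge 0$ let $\hat\sigma(p,q)\in(0,1)$ be the unique solution $s$ of $\frac{p\,s}{\sqrt{1-s^2}}+\frac{q\,s}{\sqrt{\beta^2-s^2}}=1$. For $k\in\mathbb{N}=\{0,1,2,\dots\}$ set, with $s=\hat\sigma(k+1,k)$, $$l(2k,\beta)=\frac{k+1}{\sqrt{1-s^2}}+\frac{\beta^2k}{\sqrt{\beta^2-s^2}}-2k-\sqrt2 ,$$ and let $\beta^c_0$ be the unique $\beta\in(1,\sqrt2)$ with $l(2,\beta)=l(0,\beta)$.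 For $m,r\in\mathbb{N}$, an $S_3$-path from $(2m+r,r)$ to $(2m+r+3,r+1)$ is the geodesic (curve of minimal optical length) between these two points in the layered structure whose index is $1$ where $\lfloor x+r\rfloor$ is even and $\beta$ where $\lfloor x+r\rfloor$ is odd. **Theorem.** Let $\sqrt{3/2}\le\beta<\beta^c_0$, let $n,j\ge1$ be integers, and let $\Gamma$ be a geodesic for $a_\beta$ from $O=(0,0)$ to the light vertex $(2n+j,j)$. For $k=0,\dots,n$ let $A_k$ and $B_k$ be the first and the last point of $\Gamma$ on $D_k$. Then: 1. for every $k=0,\dots,n$, $\Gamma\cap D_k$ is the segment $[A_k,B_k]$, the ordinate of $A_k$ is at most that of $B_k$, and $A_k$ and $B_k$ are light vertices; 2. for every $k=1,\dots,n$, $\Gamma$ reaches $A_k$ not before it leaves $B_{k-1}$, and the part of $\Gamma$ from $B_{k-1}$ to $A_k$ is either a horizontal segment or an $S_3$-path. -/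

import Mathlib

open MeasureTheory Set

noncomputable section

namespace Chessboard

/-- The Euclidean plane. -/
abbrev Plane : Type := EuclideanSpace ℝ (Fin 2)

/-- The point with coordinates `(x, y)`. -/
def pt (x y : ℝ) : Plane := !₂[x, y]

/-! ### Refractive indices, optical length, geodesics -/

/-- The standard chessboard index: it equals `β` on the open unit squares whose lower left corner
`(p, q) ∈ ℤ × ℤ` has `p + q` odd (the dark squares), and `1` elsewhere; in particular it is `1`
on all sides of the squares. -/
def chessIndex (β : ℝ) (P : Plane) : ℝ :=
  open Classical in
  if Odd (⌊P 0⌋ + ⌊P 1⌋) ∧ Int.fract (P 0) ≠ 0 ∧ Int.fract (P 1) ≠ 0 then β else 1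

/-- The index of the parallel layer structure that corresponds to the horizontal strip
`{r ≤ y ≤ r + 1}` of the chessboard: `1` if `⌊x + r⌋` is even and `β` if it is odd. -/
def layerIndex (β : ℝ) (r : ℤ) (P : Plane) : ℝ :=
  open Classical in
  if Even ⌊P 0 + r⌋ then 1 else β

/-- The optical length `∫₀¹ a(u(t)) |u'(t)| dt` of a curve `u` on `[0, 1]` in the structure with
index `a`. -/
def opticalLength (a : Plane → ℝ) (u : ℝ → Plane) : ℝ :=
  ∫ t in (0 : ℝ)..1, a (u t) * ‖deriv u t‖

/-- `u` is an absolutely continuous curve on `[0, 1]` from `P` to `Q`. -/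
structure IsCurve (P Q : Plane) (u : ℝ → Plane) : Prop where
  ac : AbsolutelyContinuousOnInterval u 0 1
  source : u 0 = P
  target : u 1 = Q

/-- `u` parametrizes, on `[0, 1]`, a geodesic from `P` to `Q` in the structure with index `a`:
it has minimal optical length among the absolutely continuous curves from `P` to `Q`. -/
structure IsGeodesic (a : Plane → ℝ) (P Q : Plane) (u : ℝ → Plane) : Prop where
  isCurve : IsCurve P Q u
  minimal : ∀ v : ℝ → Plane, IsCurve P Q v → opticalLength a u ≤ opticalLength a v

/-! ### Light diagonals, light vertices, entry and exit points -/

/-- The light diagonal `D_k`, of equation `y = x - 2k`. -/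
def lightDiagonal (k : ℤ) : Set Plane := {P | P 1 = P 0 - 2 * k}

/-- A light vertex: a point with integer coordinates that lies on a light diagonal. -/
def IsLightVertex (P : Plane) : Prop :=
  (∃ x y : ℤ, P = pt x y) ∧ ∃ k : ℤ, P ∈ lightDiagonal k

/-- The first time at which the curve `u` is on the light diagonal `D_k`. -/
def entryTime (u : ℝ → Plane) (k : ℤ) : ℝ := sInf {t | t ∈ Icc (0 : ℝ) 1 ∧ u t ∈ lightDiagonal k}

/-- The last time at which the curve `u` is on the light diagonal `D_k`. -/
def exitTime (u : ℝ → Plane) (k : ℤ) : ℝ := sSup {t | t ∈ Icc (0 : ℝ) 1 ∧ u t ∈ lightDiagonal k}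

/-- The entry point `A_k` of the curve `u` on the light diagonal `D_k`. -/
def entryPoint (u : ℝ → Plane) (k : ℤ) : Plane := u (entryTime u k)

/-- The exit point `B_k` of the curve `u` from the light diagonal `D_k`. -/
def exitPoint (u : ℝ → Plane) (k : ℤ) : Plane := u (exitTime u k)

/-! ### Snell paths -/

/-- `S` is the Snell path from `P` to `Q` in the strip `{r ≤ y ≤ r + 1}`: the (image of the)
geodesic from `P` to `Q` in the corresponding parallel layer structure. -/
def IsSnellPath (β : ℝ) (r : ℤ) (P Q : Plane) (S : Set Plane) : Prop :=
  ∃ w : ℝ → Plane, IsGeodesic (layerIndex β r) P Q w ∧ S = w '' Icc 0 1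

/-- `S` is an `S₃`-path from `P` to `Q`: a Snell path from `P = (2m + r, r)` to
`Q = (2m + r + 3, r + 1)`, for some `m, r ∈ ℕ`. -/
def IsS3Path (β : ℝ) (P Q : Plane) (S : Set Plane) : Prop :=
  ∃ m r : ℕ, P = pt (2 * m + r) r ∧ Q = pt (2 * m + r + 3) (r + 1) ∧ IsSnellPath β r P Q S

/-! ### The normalized length and the critical values -/

/-- Sine of the angle of incidence in the light strips for a Snell path of height `h` that crosses
light strips of total thickness `p` and dark strips of total thickness `q`: for `p > 0`, `q ≥ 0`
this is the unique `s ∈ (-1, 1)` that solves the displayed equation. -/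
def snellSine (β p q h : ℝ) : ℝ :=
  sInf {s | s ∈ Ioo (-1 : ℝ) 1 ∧ p * s / √(1 - s ^ 2) + q * s / √(β ^ 2 - s ^ 2) = h}

/-- Optical length of such a Snell path. -/
def snellLength (β p q h : ℝ) : ℝ :=
  p / √(1 - snellSine β p q h ^ 2) + β ^ 2 * q / √(β ^ 2 - snellSine β p q h ^ 2)

/-- Thickness of the dark zone crossed by the Snell path from `(0, 0)` to `(t + 1, 1)`. -/
def darkThickness (t : ℝ) : ℝ :=
  open Classical in
  if Odd ⌊t⌋ then (⌊t + 1⌋ : ℝ) / 2 else t - (⌊t⌋ : ℝ) / 2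

/-- Thickness of the light zone crossed by the Snell path from `(0, 0)` to `(t + 1, 1)`. -/
def lightThickness (t : ℝ) : ℝ := t + 1 - darkThickness t

/-- The normalized length `l(t, β)`. -/
def normalizedLength (t β : ℝ) : ℝ :=
  snellLength β (lightThickness t) (darkThickness t) 1 - t - √2

/-- `δ(k, β) = l(2k + 2, β) - l(2k, β)`. -/
def lengthGap (k : ℕ) (β : ℝ) : ℝ :=
  normalizedLength (2 * k + 2) β - normalizedLength (2 * k) β

/-- The critical value `β^c_k`: the unique zero of `δ(k, ·)` in `(1, √2)`. -/
def criticalIndex (k : ℕ) : ℝ := sInf {b | b ∈ Ioo 1 (√2) ∧ lengthGap k b = 0}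

end Chessboard

end

open Chessboard

namespace Chessboard

/-! ### Absolutely continuous curves -/

/-! Cut Γ at its first and last passages through each D_k. The index is 1 on D_k, so between these
passages Γ is a segment of D_k, of length √2 |Δy| (`image_inter_lightDiagonal`). What remains is to
bound the cost of a crossing from D_k to D_{k+1} in terms of its rise x.

Put l = l(2, β). Then l < 0: l(0, ·) vanishes, and l(2, ·) is continuous, negative at √(3/2) and
without zeros before β^c_0 (`normalizedLength_two_neg`). A horizontal crossing costs 2 and an
S₃-path costs 2 + √2 + l. Let N(x) = 2 + √2 x + l min(1, x), which takes these values at x = 0 and x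
= 1. By `Crossing.trichotomy` every crossing costs strictly more than N(x), unless it starts at a
light vertex and x is 0 or 1; then it costs at least N(x), and for x = 1 equality forces the Snell
polyline.

The lower bounds are calibrations: if p² + q² ≤ κ², a displacement (x, y) through index at least κ
costs at least p x + q y (`le_mul_sqrt`). Inside one row the momenta are those of the Snell path,
(c₁, s) in light and (c₂, s) in dark squares. The heights at which the grid lines are crossed
cancel, and the excess over N(x) is at least (c₁ + c₂ - 2)(1 - x), where c₁ + c₂ > 2 because β² ≥
3/2. The momenta (√2/2, √2/2) in light and (1, √2/2) in dark squares, again admissible because β² ≥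
3/2, show that Γ cannot leave the row through its top before passing x = 2
(`DarkCrossing.y_lt_one`), and they help to exclude crossings that end in higher rows.

Since l < 0, N is the maximum of the affine functions 2 + l + √2 x and 2 + (√2 + l) x. Summing an
affine minorant α + γ x over all crossings, and γ Δy over all diagonal pieces, gives the lower bound
α n + γ j. A competitor attains it: n S₃-paths and then a diagonal if n ≤ j, or j S₃-paths and then
a horizontal segment if j ≤ n. Hence no piece of Γ has slack (`slack_nonpos`): the strict
alternative never occurs, and diagonals are followed upwards. -/

theorem _root_.AbsolutelyContinuousOnInterval.lipschitz_comp {X Y : Type*} [PseudoMetricSpace X]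
    [PseudoMetricSpace Y] {f : ℝ → X} {a b : ℝ} (hf : AbsolutelyContinuousOnInterval f a b)
    {g : X → Y} {K : NNReal} (hg : LipschitzWith K g) :
    AbsolutelyContinuousOnInterval (fun t => g (f t)) a b := by
  refine squeeze_zero (fun E => Finset.sum_nonneg fun i _ => dist_nonneg) (fun E => ?_)
    (by simpa using Filter.Tendsto.const_mul (K : ℝ) hf)
  rw [Finset.mul_sum]
  exact Finset.sum_le_sum fun i _ => hg.dist_le_mul _ _

/-- A monotone map keeps the intervals disjoint and its Lipschitz constant controls their total
length. Strict monotonicity is not asked, so that reparametrizations may be clamped, as in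
`Joins.trans`. -/
theorem _root_.AbsolutelyContinuousOnInterval.comp_monotone {X : Type*} [PseudoMetricSpace X]
    {f : ℝ → X} {a b c d : ℝ} (hf : AbsolutelyContinuousOnInterval f c d) {g : ℝ → ℝ} {K : NNReal}
    (hg : LipschitzWith K g) (hm : Monotone g) (hmap : MapsTo g (uIcc a b) (uIcc c d)) :
    AbsolutelyContinuousOnInterval (fun t => f (g t)) a b := by
  rw [absolutelyContinuousOnInterval_iff] at hf ⊢
  intro ε hε
  obtain ⟨δ, hδ, h⟩ := hf ε hε
  refine ⟨δ / (K + 1), by positivity, fun E hE hlen => ?_⟩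
  refine h (E.1, fun i => (g (E.2 i).1, g (E.2 i).2)) ⟨fun i hi => ?_, ?_⟩ ?_
  · exact ⟨hmap (hE.1 i hi).1, hmap (hE.1 i hi).2⟩
  · intro i hi k hk hik
    have hd := hE.2 hi hk hik
    simp only [Function.onFun, disjoint_left, uIoc, mem_Ioc] at hd ⊢
    rintro y ⟨hy1, hy2⟩ ⟨hy3, hy4⟩
    simp only [← hm.map_min, ← hm.map_max] at hy1 hy2 hy3 hy4
    have e1 : min (E.2 i).1 (E.2 i).2 < max (E.2 k).1 (E.2 k).2 := by
      by_contra hc; exact absurd (hm (not_lt.1 hc)) (by linarith)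
    have e2 : min (E.2 k).1 (E.2 k).2 < max (E.2 i).1 (E.2 i).2 := by
      by_contra hc; exact absurd (hm (not_lt.1 hc)) (by linarith)
    have e3 : min (E.2 k).1 (E.2 k).2 < max (E.2 k).1 (E.2 k).2 := by
      by_contra hc; exact absurd (hm (not_lt.1 hc)) (by linarith)
    have e4 : min (E.2 i).1 (E.2 i).2 < max (E.2 i).1 (E.2 i).2 := by
      by_contra hc; exact absurd (hm (not_lt.1 hc)) (by linarith)
    refine hd (a := min (max (E.2 i).1 (E.2 i).2) (max (E.2 k).1 (E.2 k).2))
      ⟨lt_min e4 e1, min_le_left _ _⟩ ⟨lt_min e2 e3, min_le_right _ _⟩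
  · calc ∑ i ∈ Finset.range E.1, dist (g (E.2 i).1) (g (E.2 i).2)
        ≤ ∑ i ∈ Finset.range E.1, K * dist (E.2 i).1 (E.2 i).2 :=
          Finset.sum_le_sum fun i _ => hg.dist_le_mul _ _
      _ = K * ∑ i ∈ Finset.range E.1, dist (E.2 i).1 (E.2 i).2 := (Finset.mul_sum ..).symm
      _ ≤ (K + 1) * ∑ i ∈ Finset.range E.1, dist (E.2 i).1 (E.2 i).2 := by
          gcongr; simp
      _ < δ := by rwa [lt_div_iff₀' (by positivity)] at hlen

theorem lipschitz_coord (i : Fin 2) : LipschitzWith 1 (fun P : Plane => P i) :=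
  LipschitzWith.of_dist_le_mul fun P Q => by
    simpa [dist_eq_norm] using PiLp.norm_apply_le (P - Q) i

theorem ae_differentiableAt {u : ℝ → Plane} {s t : ℝ} (hu : AbsolutelyContinuousOnInterval u s t) :
    ∀ᵐ r, r ∈ uIcc s t → DifferentiableAt ℝ u r := by
  filter_upwards [(hu.lipschitz_comp (lipschitz_coord 0)).ae_differentiableAt,
    (hu.lipschitz_comp (lipschitz_coord 1)).ae_differentiableAt] with r h0 h1 hr
  rw [differentiableAt_euclidean]
  intro i
  fin_cases i
  exacts [h0 hr, h1 hr]

theorem deriv_coord {u : ℝ → Plane} {r : ℝ} (h : DifferentiableAt ℝ u r) (i : Fin 2) :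
    deriv (fun x => u x i) r = deriv u r i :=
  (hasDerivAt_pi.1 ((PiLp.continuousLinearEquiv 2 ℝ (fun _ : Fin 2 => ℝ)).hasFDerivAt.comp_hasDerivAt r
    h.hasDerivAt) i).deriv

theorem norm_plane (P : Plane) : ‖P‖ = √(P 0 ^ 2 + P 1 ^ 2) := by
  simp [EuclideanSpace.norm_eq, Fin.sum_univ_two]

/-- A measurable refractive index with values in `[1, M]`. -/
structure IsIndex (a : Plane → ℝ) (M : ℝ) : Prop where
  measurable : Measurable a
  one_le : ∀ P, 1 ≤ a P
  le : ∀ P, a P ≤ M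

/-- Optical length of the arc of `u` over `[s, t]`. -/
noncomputable def cost (a : Plane → ℝ) (u : ℝ → Plane) (s t : ℝ) : ℝ :=
  ∫ r in s..t, a (u r) * ‖deriv u r‖

/-! ### Optical length: integrability, additivity, lower bounds -/

theorem intervalIntegrable_norm_deriv {u : ℝ → Plane} {s t : ℝ}
    (hu : AbsolutelyContinuousOnInterval u s t) :
    IntervalIntegrable (fun r => ‖deriv u r‖) volume s t := by
  have h0 := (hu.lipschitz_comp (lipschitz_coord 0)).intervalIntegrable_deriv
  have h1 := (hu.lipschitz_comp (lipschitz_coord 1)).intervalIntegrable_deriv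
  refine (h0.abs.add h1.abs).mono_fun (measurable_deriv u).norm.aestronglyMeasurable ?_
  rw [Filter.EventuallyLE, ae_restrict_iff' measurableSet_uIoc]
  filter_upwards [ae_differentiableAt hu] with r hd hr
  have hd := hd (uIoc_subset_uIcc hr)
  rw [deriv_coord hd, deriv_coord hd, norm_norm, norm_plane, Real.norm_eq_abs,
    abs_of_nonneg (a := |_| + |_|) (by positivity)]
  rw [Real.sqrt_le_left (by positivity)]
  nlinarith [sq_abs (deriv u r 0), sq_abs (deriv u r 1), abs_nonneg (deriv u r 0),
    abs_nonneg (deriv u r 1), mul_nonneg (abs_nonneg (deriv u r 0)) (abs_nonneg (deriv u r 1))]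

theorem IsIndex.intervalIntegrable {a : Plane → ℝ} {M : ℝ} (ha : IsIndex a M) {u : ℝ → Plane}
    {s t : ℝ} (hu : AbsolutelyContinuousOnInterval u s t) :
    IntervalIntegrable (fun r => a (u r) * ‖deriv u r‖) volume s t := by
  refine ((intervalIntegrable_norm_deriv hu).const_mul M).mono_fun ?_ ?_
  · refine AEStronglyMeasurable.mul ?_ (measurable_deriv u).norm.aestronglyMeasurable
    exact (ha.measurable.comp_aemeasurable ((hu.continuousOn.mono uIoc_subset_uIcc).aemeasurable
      measurableSet_uIoc)).aestronglyMeasurable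
  · refine Filter.Eventually.of_forall fun r => ?_
    have h1 := ha.one_le (u r)
    have h2 := ha.le (u r)
    simp only [norm_mul, Real.norm_eq_abs]
    gcongr

theorem uIcc_subset_unit {s t : ℝ} (hs : 0 ≤ s) (hst : s ≤ t) (ht : t ≤ 1) :
    uIcc s t ⊆ uIcc 0 1 := by
  rw [uIcc_of_le hst, uIcc_of_le zero_le_one]
  exact Icc_subset_Icc hs ht

theorem IsIndex.cost_add {a : Plane → ℝ} {M : ℝ} (ha : IsIndex a M) {u : ℝ → Plane}
    (hu : AbsolutelyContinuousOnInterval u 0 1) {r s t : ℝ} (hr : 0 ≤ r) (hrs : r ≤ s)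
    (hst : s ≤ t) (ht : t ≤ 1) : cost a u r t = cost a u r s + cost a u s t :=
  (intervalIntegral.integral_add_adjacent_intervals
    (ha.intervalIntegrable (hu.mono (uIcc_subset_unit hr hrs (hst.trans ht))))
    (ha.intervalIntegrable (hu.mono (uIcc_subset_unit (hr.trans hrs) hst ht)))).symm

/-- Test u' against the displacement e: |e|² = ∫⟨e, u'⟩ ≤ |e| ∫|u'|. The bound on the index is
needed only on the open interval, so an arc through a dark square may have its ends on the sides,
where the index drops to 1. -/
theorem IsIndex.mul_norm_le_cost {a : Plane → ℝ} {M : ℝ} (ha : IsIndex a M) {u : ℝ → Plane}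
    (hu : AbsolutelyContinuousOnInterval u 0 1) {s t : ℝ} (hs : 0 ≤ s)
    (hst : s ≤ t) (ht : t ≤ 1) {κ : ℝ} (hκ : ∀ r ∈ Ioo s t, κ ≤ a (u r)) :
    κ * ‖u t - u s‖ ≤ cost a u s t := by
  have hu' := hu.mono (uIcc_subset_unit hs hst ht)
  rcases eq_or_ne (u t - u s) 0 with h0 | h0
  · rw [h0, norm_zero, mul_zero]
    exact intervalIntegral.integral_nonneg hst fun r _ =>
      mul_nonneg (by linarith [ha.one_le (u r)]) (norm_nonneg _)
  set e := u t - u s with he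
  have hf : AbsolutelyContinuousOnInterval (fun r => inner ℝ e (u r)) s t :=
    hu'.lipschitz_comp (innerSL ℝ e).lipschitz
  have hderiv : ∀ᵐ r, r ∈ uIcc s t →
      deriv (fun r => inner ℝ e (u r)) r = inner ℝ e (deriv u r) := by
    filter_upwards [ae_differentiableAt hu'] with r hr hm
    exact ((innerSL ℝ e).hasFDerivAt.comp_hasDerivAt r (hr hm).hasDerivAt).deriv
  have h1 : ‖e‖ * ‖e‖ = ∫ r in s..t, deriv (fun r => inner ℝ e (u r)) r := by
    rw [hf.integral_deriv_eq_sub, ← inner_sub_right, ← he, real_inner_self_eq_norm_mul_norm]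
  have h3 : ∫ r in s..t, deriv (fun r => inner ℝ e (u r)) r ≤ ∫ r in s..t, ‖e‖ * ‖deriv u r‖ := by
    refine intervalIntegral.integral_mono_ae_restrict hst hf.intervalIntegrable_deriv
      ((intervalIntegrable_norm_deriv hu').const_mul _) ?_
    rw [Filter.EventuallyLE, ae_restrict_iff' measurableSet_Icc]
    filter_upwards [hderiv] with r hr hm
    rw [hr (Icc_subset_uIcc hm)]
    exact real_inner_le_norm _ _
  have h2 : ‖e‖ ≤ ∫ r in s..t, ‖deriv u r‖ := by
    rw [← h1, intervalIntegral.integral_const_mul] at h3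
    exact le_of_mul_le_mul_left h3 (norm_pos_iff.2 h0)
  have h4 : ∫ r in s..t, κ * ‖deriv u r‖ ≤ cost a u s t := by
    refine intervalIntegral.integral_mono_on_of_le_Ioo hst
      ((intervalIntegrable_norm_deriv hu').const_mul _) (ha.intervalIntegrable hu') ?_
    intro r hr
    exact mul_le_mul_of_nonneg_right (hκ r hr) (norm_nonneg _)
  rw [intervalIntegral.integral_const_mul] at h4
  rcases le_total 0 κ with hk | hk
  · exact (mul_le_mul_of_nonneg_left h2 hk).trans h4
  · refine (mul_nonpos_of_nonpos_of_nonneg hk (norm_nonneg _)).trans ?_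
    exact intervalIntegral.integral_nonneg hst fun r _ =>
      mul_nonneg (by linarith [ha.one_le (u r)]) (norm_nonneg _)

theorem IsIndex.norm_le_cost {a : Plane → ℝ} {M : ℝ} (ha : IsIndex a M) {u : ℝ → Plane}
    (hu : AbsolutelyContinuousOnInterval u 0 1) {s t : ℝ} (hs : 0 ≤ s)
    (hst : s ≤ t) (ht : t ≤ 1) : ‖u t - u s‖ ≤ cost a u s t := by
  simpa using ha.mul_norm_le_cost hu hs hst ht (κ := 1) fun r _ => ha.one_le _

theorem continuousOn_of_ac {u : ℝ → Plane} (hu : AbsolutelyContinuousOnInterval u 0 1) :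
    ContinuousOn u (Icc 0 1) := by
  simpa using hu.continuousOn

theorem wbtw_iff_norm {A P B : Plane} : Wbtw ℝ A P B ↔ ‖P - A‖ + ‖B - P‖ = ‖B - A‖ := by
  rw [← dist_add_dist_eq_iff, dist_eq_norm, dist_eq_norm, dist_eq_norm, norm_sub_rev A P,
    norm_sub_rev P B, norm_sub_rev A B]

/-- An arc whose optical length is the least possible for the lower bound `κ` of the index along
it is a segment. -/
theorem IsIndex.image_eq_segment {a : Plane → ℝ} {M : ℝ} (ha : IsIndex a M) {u : ℝ → Plane}
    (hu : AbsolutelyContinuousOnInterval u 0 1) {s t : ℝ} (hs : 0 ≤ s)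
    (hst : s ≤ t) (ht : t ≤ 1) {κ : ℝ} (hk0 : 0 < κ) (hκ : ∀ r ∈ Ioo s t, κ ≤ a (u r))
    (hle : cost a u s t ≤ κ * ‖u t - u s‖) :
    u '' Icc s t = segment ℝ (u s) (u t) := by
  have key : ∀ r ∈ Icc s t, ‖u r - u s‖ + ‖u t - u r‖ = ‖u t - u s‖ := by
    intro r hr
    have h1 := ha.mul_norm_le_cost hu hs hr.1 (hr.2.trans ht)
      (fun x hx => hκ x ⟨hx.1, hx.2.trans_le hr.2⟩)
    have h2 := ha.mul_norm_le_cost hu (hs.trans hr.1) hr.2 ht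
      (fun x hx => hκ x ⟨hr.1.trans_lt hx.1, hx.2⟩)
    rw [ha.cost_add hu hs hr.1 hr.2 ht] at hle
    apply le_antisymm
    · have : κ * (‖u r - u s‖ + ‖u t - u r‖) ≤ κ * ‖u t - u s‖ := by linarith
      exact le_of_mul_le_mul_left this hk0
    · have := norm_add_le (u r - u s) (u t - u r)
      rwa [sub_add_sub_cancel', ] at this
  have hsub : u '' Icc s t ⊆ segment ℝ (u s) (u t) := by
    rintro _ ⟨r, hr, rfl⟩
    exact mem_segment_iff_wbtw.2 (wbtw_iff_norm.2 (key r hr))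
  refine hsub.antisymm fun P hP => ?_
  have hc : ContinuousOn (fun r => ‖u r - u s‖) (Icc s t) :=
    (((continuousOn_of_ac hu).mono (Icc_subset_Icc hs ht)).sub continuousOn_const).norm
  have h2 : Wbtw ℝ (u s) P (u t) := mem_segment_iff_wbtw.1 hP
  have hP := wbtw_iff_norm.1 h2
  -- The arc fills the segment: the distance to `u s` takes all intermediate values, and it
  -- determines a point of the segment.
  obtain ⟨r, hr, hre⟩ := intermediate_value_Icc hst hc
    (show ‖P - u s‖ ∈ Icc ‖u s - u s‖ ‖u t - u s‖ by
      simp only [sub_self, norm_zero, mem_Icc, norm_nonneg, true_and]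
      linarith [norm_nonneg (u t - P)])
  refine ⟨r, hr, ?_⟩
  have h1 : Wbtw ℝ (u s) (u r) (u t) := mem_segment_iff_wbtw.1 (hsub ⟨r, hr, rfl⟩)
  obtain ⟨p, hp, hp'⟩ := h1
  obtain ⟨q, hq, hq'⟩ := h2
  have e1 : u r - u s = p • (u t - u s) := by rw [← hp', AffineMap.lineMap_apply]; simp
  have e2 : P - u s = q • (u t - u s) := by rw [← hq', AffineMap.lineMap_apply]; simp
  simp only [e1, e2, norm_smul, Real.norm_eq_abs, abs_of_nonneg hp.1, abs_of_nonneg hq.1] at hre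
  have : u r - u s = P - u s := by
    rcases eq_or_ne (u t - u s) 0 with h0 | h0
    · rw [e1, e2, h0, smul_zero, smul_zero]
    · rw [e1, e2, mul_right_cancel₀ (norm_ne_zero_iff.2 h0) hre]
  exact sub_left_injective this

/-! ### Joining points by curves -/

/-- Some curve from `P` to `Q` with image `S` has optical length at most `c`. -/
def Joins (a : Plane → ℝ) (P Q : Plane) (S : Set Plane) (c : ℝ) : Prop :=
  ∃ v : ℝ → Plane, IsCurve P Q v ∧ v '' Icc 0 1 = S ∧ opticalLength a v ≤ c

theorem Joins.mono {a : Plane → ℝ} {P Q : Plane} {S : Set Plane} {c d : ℝ}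
    (h : Joins a P Q S c) (hcd : c ≤ d) : Joins a P Q S d := by
  obtain ⟨v, h1, h2, h3⟩ := h
  exact ⟨v, h1, h2, h3.trans hcd⟩

theorem lipschitz_affine (c d : ℝ) : LipschitzWith ‖c‖₊ (fun t : ℝ => d + c * t) :=
  LipschitzWith.of_dist_le_mul fun x y => by
    simp [Real.dist_eq, ← mul_sub, abs_mul]

theorem deriv_comp_affine (u : ℝ → Plane) (c d r : ℝ) :
    deriv (fun t => u (d + c * t)) r = c • deriv u (d + c * r) := by
  have h1 := deriv_comp_mul_left c (fun x => u (d + x)) r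
  rw [h1, deriv_comp_const_add]

theorem cost_comp_affine (a : Plane → ℝ) (u : ℝ → Plane) {c : ℝ} (hc : 0 ≤ c) (d s t : ℝ) :
    cost a (fun r => u (d + c * r)) s t = cost a u (d + c * s) (d + c * t) := by
  unfold cost
  rw [← intervalIntegral.mul_integral_comp_add_mul (f := fun r => a (u r) * ‖deriv u r‖),
    ← intervalIntegral.integral_const_mul]
  refine intervalIntegral.integral_congr fun r _ => ?_
  simp only [deriv_comp_affine, norm_smul, Real.norm_eq_abs, abs_of_nonneg hc]
  ring

theorem cost_congr {a : Plane → ℝ} {u v : ℝ → Plane} {s t : ℝ} (hst : s ≤ t)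
    (h : ∀ r ∈ Ioo s t, u r = v r) : cost a u s t = cost a v s t := by
  unfold cost
  rw [intervalIntegral.integral_of_le hst, intervalIntegral.integral_of_le hst,
    integral_Ioc_eq_integral_Ioo, integral_Ioc_eq_integral_Ioo]
  refine setIntegral_congr_fun measurableSet_Ioo fun r hr => ?_
  have he : u =ᶠ[nhds r] v := Filter.eventually_of_mem (isOpen_Ioo.mem_nhds hr) h
  simp only [h r hr, he.deriv_eq]

theorem joins_subarc {a : Plane → ℝ} {u : ℝ → Plane}
    (hu : AbsolutelyContinuousOnInterval u 0 1) {s t : ℝ} (hs : 0 ≤ s) (hst : s ≤ t) (ht : t ≤ 1) :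
    Joins a (u s) (u t) (u '' Icc s t) (cost a u s t) := by
  refine ⟨fun r => u (s + (t - s) * r), ⟨?_, by simp, by simp⟩, ?_, ?_⟩
  · refine hu.comp_monotone (lipschitz_affine _ _) (fun x y hxy => ?_) fun x hx => ?_
    · have := mul_le_mul_of_nonneg_left hxy (sub_nonneg.2 hst)
      simpa using this
    · rw [uIcc_of_le zero_le_one] at hx ⊢
      constructor <;> nlinarith [hx.1, hx.2]
  · rw [show (fun r => u (s + (t - s) * r)) = u ∘ (fun r => s + (t - s) * r) from rfl, image_comp]
    congr 1
    ext x
    constructor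
    · rintro ⟨r, hr, rfl⟩
      constructor <;> nlinarith [hr.1, hr.2]
    · intro hx
      rcases hst.eq_or_lt with rfl | hlt
      · exact ⟨0, by simp, by simp [le_antisymm hx.2 hx.1]⟩
      · refine ⟨(x - s) / (t - s), ⟨div_nonneg (by linarith [hx.1]) (by linarith), ?_⟩, ?_⟩
        · rw [div_le_one (by linarith)]
          linarith [hx.2]
        · have : t - s ≠ 0 := by linarith
          field_simp
          ring
  · have := cost_comp_affine a u (sub_nonneg.2 hst) s 0 1
    simp only [mul_zero, add_zero, mul_one, add_sub_cancel] at this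
    exact this.le

theorem Joins.trans {a : Plane → ℝ} {M : ℝ} (ha : IsIndex a M) {P Q R : Plane}
    {S S' : Set Plane} {c d : ℝ}
    (h : Joins a P Q S c) (h' : Joins a Q R S' d) : Joins a P R (S ∪ S') (c + d) := by
  obtain ⟨v, ⟨hv, hv0, hv1⟩, rfl, hc⟩ := h
  obtain ⟨w, ⟨hw, hw0, hw1⟩, rfl, hd⟩ := h'
  -- Concatenation as a sum of clamped curves: on each half one summand is frozen at Q, and absolute
  -- continuity follows from that of sums.
  set z : ℝ → Plane := fun t => v (min (0 + 2 * t) 1) + w (max (-1 + 2 * t) 0) - Q with hz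
  have hleft : ∀ t ≤ 1 / 2, z t = v (0 + 2 * t) := by
    intro t ht
    simp only [hz]
    rw [min_eq_left (by linarith), max_eq_right (by linarith), hw0, add_sub_cancel_right]
  have hright : ∀ t ≥ 1 / 2, z t = w (-1 + 2 * t) := by
    intro t ht
    simp only [hz]
    rw [min_eq_right (by linarith), max_eq_left (by linarith), hv1, add_sub_cancel_left]
  have hzac : AbsolutelyContinuousOnInterval z 0 1 := by
    refine AbsolutelyContinuousOnInterval.sub (f := fun t => v (min (0 + 2 * t) 1) + w (max (-1 + 2 * t) 0))
      (AbsolutelyContinuousOnInterval.add ?_ ?_)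
      (LipschitzWith.const Q).lipschitzOnWith.absolutelyContinuousOnInterval
    · refine hv.comp_monotone ((lipschitz_affine 2 0).min_const 1) (fun x y hxy => ?_) fun x hx => ?_
      · exact min_le_min_right _ (by linarith)
      · rw [uIcc_of_le zero_le_one] at hx ⊢
        exact ⟨le_min (by linarith [hx.1]) zero_le_one, min_le_right _ _⟩
    · refine hw.comp_monotone ((lipschitz_affine 2 (-1)).max_const 0) (fun x y hxy => ?_) fun x hx => ?_
      · exact max_le_max_right _ (by linarith)
      · rw [uIcc_of_le zero_le_one] at hx ⊢
        exact ⟨le_max_right _ _, max_le (by linarith [hx.2]) zero_le_one⟩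
  refine ⟨z, ⟨hzac, ?_, ?_⟩, ?_, ?_⟩
  · rw [hleft 0 (by norm_num)]; simp [hv0]
  · rw [hright 1 (by norm_num)]; norm_num [hw1]
  · ext X
    constructor
    · rintro ⟨t, ht, rfl⟩
      rcases le_total t (1 / 2) with h | h
      · rw [hleft t h]
        exact Or.inl ⟨_, ⟨by linarith [ht.1], by linarith⟩, rfl⟩
      · rw [hright t h]
        exact Or.inr ⟨_, ⟨by linarith, by linarith [ht.2]⟩, rfl⟩
    · rintro (⟨t, ht, rfl⟩ | ⟨t, ht, rfl⟩)
      · refine ⟨t / 2, ⟨by linarith [ht.1], by linarith [ht.2]⟩, ?_⟩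
        rw [hleft _ (by linarith [ht.2])]
        congr 1; ring
      · refine ⟨(t + 1) / 2, ⟨by linarith [ht.1], by linarith [ht.2]⟩, ?_⟩
        rw [hright _ (by linarith [ht.1])]
        congr 1; ring
  · have e := ha.cost_add hzac (r := 0) (s := 1 / 2) (t := 1) le_rfl (by norm_num) (by norm_num) le_rfl
    have e1 : cost a z 0 (1 / 2) = cost a v 0 1 := by
      rw [cost_congr (v := fun t => v (0 + 2 * t)) (by norm_num) fun r hr => hleft r hr.2.le,
        cost_comp_affine a v zero_le_two]
      norm_num
    have e2 : cost a z (1 / 2) 1 = cost a w 0 1 := by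
      rw [cost_congr (v := fun t => w (-1 + 2 * t)) (by norm_num) fun r hr => hright r hr.1.le,
        cost_comp_affine a w zero_le_two]
      norm_num
    change cost a z 0 1 ≤ _
    rw [e, e1, e2]
    exact add_le_add hc hd

theorem joins_segment {a : Plane → ℝ} {M : ℝ} (ha : IsIndex a M) {P Q : Plane} {κ : ℝ}
    (h : ∀ r ∈ Ioo (0 : ℝ) 1, a (AffineMap.lineMap P Q r) ≤ κ) :
    Joins a P Q (segment ℝ P Q) (κ * ‖Q - P‖) := by
  have hd : ∀ r, HasDerivAt (AffineMap.lineMap P Q : ℝ → Plane) (Q - P) r := fun r =>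
    AffineMap.hasDerivAt_lineMap
  have hac : AbsolutelyContinuousOnInterval (AffineMap.lineMap P Q : ℝ → Plane) 0 1 := 
    (lipschitzWith_lineMap P Q).lipschitzOnWith.absolutelyContinuousOnInterval
  refine ⟨AffineMap.lineMap P Q, ⟨hac, by simp, by simp⟩, (segment_eq_image_lineMap ℝ P Q).symm, ?_⟩
  have : opticalLength a (AffineMap.lineMap P Q) ≤ ∫ t in (0 : ℝ)..1, κ * ‖Q - P‖ := by
    refine intervalIntegral.integral_mono_on_of_le_Ioo zero_le_one (ha.intervalIntegrable hac)
      (by simp) fun r hr => ?_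
    rw [(hd r).deriv]
    exact mul_le_mul_of_nonneg_right (h r hr) (norm_nonneg _)
  simpa using this

theorem ac_add_const {v : ℝ → Plane} (hv : AbsolutelyContinuousOnInterval v 0 1) (w : Plane) :
    AbsolutelyContinuousOnInterval (fun t => v t + w) 0 1 :=
  hv.lipschitz_comp (K := 1) (g := fun x => x + w) (LipschitzWith.of_dist_le_mul fun x y => by simp)

theorem Joins.translate {a b : Plane → ℝ} {w : Plane} (hw : ∀ P, a (P + w) = b P) {P Q : Plane}
    {S : Set Plane} {c : ℝ} (h : Joins b P Q S c) :
    Joins a (P + w) (Q + w) ((· + w) '' S) c := by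
  obtain ⟨v, ⟨h0, h1, h2⟩, rfl, h4⟩ := h
  refine ⟨fun t => v t + w, ⟨?_, by simp [h1], by simp [h2]⟩, ?_, ?_⟩
  · exact ac_add_const h0 w
  · rw [image_image]
  · simpa [opticalLength, hw] using h4

theorem IsGeodesic.translate {a b : Plane → ℝ} {w : Plane} (hw : ∀ P, a (P + w) = b P) {P Q : Plane}
    {u : ℝ → Plane} (h : IsGeodesic b P Q u) :
    IsGeodesic a (P + w) (Q + w) (fun t => u t + w) := by
  refine ⟨⟨?_, by simp [h.isCurve.source], by simp [h.isCurve.target]⟩, fun v hv => ?_⟩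
  · exact ac_add_const h.isCurve.ac w
  · have h1 := h.minimal (fun t => v t + -w) ⟨ac_add_const hv.ac (-w),
      by simp [hv.source], by simp [hv.target]⟩
    simp only [opticalLength, deriv_add_const, hw, ← hw (_ + -w), neg_add_cancel_right] at h1 ⊢
    exact h1

/-- Splice the competitor into the geodesic in place of the arc over [s, t] and cancel the two
remaining arcs. -/
theorem IsGeodesic.cost_le {a : Plane → ℝ} {M : ℝ} (ha : IsIndex a M) {P Q : Plane}
    {u : ℝ → Plane} (h : IsGeodesic a P Q u) {s t : ℝ} (hs : 0 ≤ s) (hst : s ≤ t) (ht : t ≤ 1)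
    {S : Set Plane} {c : ℝ} (hc : Joins a (u s) (u t) S c) : cost a u s t ≤ c := by
  have hac := h.isCurve.ac
  obtain ⟨v, hv, -, hle⟩ := ((joins_subarc (a := a) hac le_rfl hs (hst.trans ht)).trans ha hc).trans ha
    (joins_subarc hac (hs.trans hst) ht le_rfl)
  rw [h.isCurve.source, h.isCurve.target] at hv
  have h1 := h.minimal v hv
  change cost a u 0 1 ≤ _ at h1
  rw [ha.cost_add hac le_rfl hs (hst.trans ht) le_rfl, ha.cost_add hac hs hst ht le_rfl] at h1
  linarith

theorem IsGeodesic.image_eq_segment {a : Plane → ℝ} {M : ℝ} (ha : IsIndex a M) {P Q : Plane}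
    {u : ℝ → Plane} (h : IsGeodesic a P Q u) {s t : ℝ} (hs : 0 ≤ s) (hst : s ≤ t) (ht : t ≤ 1)
    (h1 : ∀ r ∈ Ioo (0 : ℝ) 1, a (AffineMap.lineMap (u s) (u t) r) ≤ 1) :
    u '' Icc s t = segment ℝ (u s) (u t) :=
  ha.image_eq_segment h.isCurve.ac hs hst ht one_pos (fun _ _ => ha.one_le _)
    (h.cost_le ha hs hst ht (joins_segment ha h1))

/-! ### The chessboard index -/

@[simp] theorem pt_zero (x y : ℝ) : pt x y 0 = x := rfl
@[simp] theorem pt_one (x y : ℝ) : pt x y 1 = y := rfl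

theorem plane_ext {P Q : Plane} (h0 : P 0 = Q 0) (h1 : P 1 = Q 1) : P = Q := by
  ext i
  fin_cases i
  exacts [h0, h1]

theorem norm_sub_plane (P Q : Plane) : ‖P - Q‖ = √((P 0 - Q 0) ^ 2 + (P 1 - Q 1) ^ 2) := by
  simp [norm_plane]

theorem lineMap_coord (P Q : Plane) (r : ℝ) (i : Fin 2) :
    AffineMap.lineMap P Q r i = P i + r * (Q i - P i) := by
  simp [AffineMap.lineMap_apply, add_comm]

theorem isIndex_chessIndex {β : ℝ} (hβ : 1 ≤ β) : IsIndex (chessIndex β) β where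
  measurable := by
    unfold chessIndex
    have m0 : Measurable fun P : Plane => P 0 := (lipschitz_coord 0).continuous.measurable
    have m1 : Measurable fun P : Plane => P 1 := (lipschitz_coord 1).continuous.measurable
    refine Measurable.ite (MeasurableSet.inter ?_ (MeasurableSet.inter ?_ ?_)) measurable_const
      measurable_const
    · exact (m0.floor.add m1.floor) (MeasurableSet.of_discrete (s := {n : ℤ | Odd n}))
    · exact (measurable_fract.comp m0) (measurableSet_singleton (0 : ℝ)).compl
    · exact (measurable_fract.comp m1) (measurableSet_singleton (0 : ℝ)).compl
  one_le P := by unfold chessIndex; split_ifs <;> simp [hβ]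
  le P := by unfold chessIndex; split_ifs <;> simp [hβ]

theorem isIndex_layerIndex {β : ℝ} (hβ : 1 ≤ β) (r : ℤ) : IsIndex (layerIndex β r) β where
  measurable := by
    unfold layerIndex
    have m0 : Measurable fun P : Plane => P 0 := (lipschitz_coord 0).continuous.measurable
    refine Measurable.ite ?_ measurable_const measurable_const
    exact (m0.add_const (r : ℝ)).floor (MeasurableSet.of_discrete (s := {n : ℤ | Even n}))
  one_le P := by unfold layerIndex; split_ifs <;> simp [hβ]
  le P := by unfold layerIndex; split_ifs <;> simp [hβ]

theorem chessIndex_add (β : ℝ) {p q : ℤ} (h : Even (p + q)) (P : Plane) :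
    chessIndex β (P + pt p q) = chessIndex β P := by
  have : Odd (⌊P 0⌋ + p + (⌊P 1⌋ + q)) ↔ Odd (⌊P 0⌋ + ⌊P 1⌋) := by
    rw [show ⌊P 0⌋ + p + (⌊P 1⌋ + q) = ⌊P 0⌋ + ⌊P 1⌋ + (p + q) by ring, Int.odd_add]
    simp [h]
  simp [chessIndex, this]

theorem layerIndex_add (β : ℝ) {p q r : ℤ} (h : Even (p + r)) (P : Plane) :
    layerIndex β r (P + pt p q) = layerIndex β 0 P := by
  have : Even (⌊P 0⌋ + (p + r)) ↔ Even ⌊P 0⌋ := by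
    rw [Int.even_add]
    simp [h]
  have e : ⌊(P + pt p q) 0 + (r : ℝ)⌋ = ⌊P 0⌋ + (p + r) := by
    rw [← Int.floor_add_intCast]
    simp [add_assoc]
  have e' : ⌊P 0 + ((0 : ℤ) : ℝ)⌋ = ⌊P 0⌋ := by simp
  unfold layerIndex
  exact if_congr (by rw [e, e', this]) rfl rfl

theorem chessIndex_of_int_left (β : ℝ) {P : Plane} {m : ℤ} (h : P 0 = m) : chessIndex β P = 1 := by
  simp [chessIndex, h]

theorem chessIndex_of_int_right (β : ℝ) {P : Plane} {m : ℤ} (h : P 1 = m) : chessIndex β P = 1 := by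
  simp [chessIndex, h]

theorem chessIndex_of_mem_lightDiagonal (β : ℝ) {P : Plane} {k : ℤ} (h : P ∈ lightDiagonal k) :
    chessIndex β P = 1 := by
  have h : P 1 = P 0 - 2 * k := h
  have e : ⌊P 1⌋ = ⌊P 0⌋ - 2 * k := by
    rw [h, show P 0 - 2 * (k : ℝ) = P 0 - ((2 * k : ℤ) : ℝ) by push_cast; ring, Int.floor_sub_intCast]
  have : ¬ Odd (⌊P 0⌋ + ⌊P 1⌋) := by
    rw [e, Int.not_odd_iff_even]
    exact ⟨⌊P 0⌋ - k, by ring⟩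
  simp [chessIndex, this]

theorem chessIndex_of_dark (β : ℝ) {P : Plane} {p q : ℤ} (hpq : Odd (p + q)) (h0 : (p : ℝ) < P 0)
    (h0' : P 0 < p + 1) (h1 : (q : ℝ) < P 1) (h1' : P 1 < q + 1) : chessIndex β P = β := by
  have e0 : ⌊P 0⌋ = p := Int.floor_eq_iff.2 ⟨h0.le, h0'⟩
  have e1 : ⌊P 1⌋ = q := Int.floor_eq_iff.2 ⟨h1.le, h1'⟩
  rw [chessIndex, if_pos]
  refine ⟨by rwa [e0, e1], ?_, ?_⟩
  · rw [Int.fract, e0]; linarith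
  · rw [Int.fract, e1]; linarith

theorem chessIndex_of_light (β : ℝ) {P : Plane} {p q : ℤ} (hpq : Even (p + q)) (h0 : (p : ℝ) ≤ P 0)
    (h0' : P 0 ≤ p + 1) (h1 : (q : ℝ) ≤ P 1) (h1' : P 1 ≤ q + 1) : chessIndex β P = 1 := by
  rcases h0'.eq_or_lt with e | h0'
  · exact chessIndex_of_int_left β (m := p + 1) (by push_cast; exact e)
  rcases h1'.eq_or_lt with e | h1'
  · exact chessIndex_of_int_right β (m := q + 1) (by push_cast; exact e)
  have e0 : ⌊P 0⌋ = p := Int.floor_eq_iff.2 ⟨h0, h0'⟩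
  have e1 : ⌊P 1⌋ = q := Int.floor_eq_iff.2 ⟨h1, h1'⟩
  rw [chessIndex, if_neg]
  rw [e0, e1]
  simp [hpq]

/-! ### The Snell path from `(0, 0)` to `(3, 1)` -/

/-- `s` is the Snell sine of the path from `(0, 0)` to `(3, 1)`, and `c₁`, `c₂` are the horizontal
components of its momentum in the light and in the dark strips. -/
structure SnellData (β s c₁ c₂ : ℝ) : Prop where
  s_pos : 0 < s
  light_pos : 0 < c₁
  dark_pos : 0 < c₂
  light_sq : c₁ ^ 2 + s ^ 2 = 1
  dark_sq : c₂ ^ 2 + s ^ 2 = β ^ 2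
  snell : 2 * s / c₁ + s / c₂ = 1

theorem snellSum_lt {β p q s s' : ℝ} (hβ : 1 ≤ β) (hp : 0 < p) (hq : 0 ≤ q) (hs : 0 < s)
    (hss : s < s') (hs' : s' < 1) :
    p * s / √(1 - s ^ 2) + q * s / √(β ^ 2 - s ^ 2) <
      p * s' / √(1 - s' ^ 2) + q * s' / √(β ^ 2 - s' ^ 2) := by
  have h1 : 0 < √(1 - s' ^ 2) := Real.sqrt_pos.2 (by nlinarith)
  have h2 : 0 < √(β ^ 2 - s' ^ 2) := Real.sqrt_pos.2 (by nlinarith)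
  have h3 : √(1 - s' ^ 2) ≤ √(1 - s ^ 2) := Real.sqrt_le_sqrt (by nlinarith)
  have h4 : √(β ^ 2 - s' ^ 2) ≤ √(β ^ 2 - s ^ 2) := Real.sqrt_le_sqrt (by nlinarith)
  have h5 : p * s / √(1 - s ^ 2) < p * s' / √(1 - s' ^ 2) := by
    apply div_lt_div₀ _ h3 _ h1 <;> nlinarith
  have h6 : q * s / √(β ^ 2 - s ^ 2) ≤ q * s' / √(β ^ 2 - s' ^ 2) := by
    apply div_le_div₀ _ _ h2 h4 <;> nlinarith
  linarith

/-- The Snell sum is nonpositive for nonpositive sines and strictly increasing for positive ones, so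
the set under the infimum is a singleton. -/
theorem snellSine_eq {β p q h s : ℝ} (hβ : 1 ≤ β) (hp : 0 < p) (hq : 0 ≤ q) (hh : 0 < h)
    (hs : 0 < s) (hs1 : s < 1) (he : p * s / √(1 - s ^ 2) + q * s / √(β ^ 2 - s ^ 2) = h) :
    snellSine β p q h = s := by
  have : {s | s ∈ Ioo (-1 : ℝ) 1 ∧ p * s / √(1 - s ^ 2) + q * s / √(β ^ 2 - s ^ 2) = h} = {s} := by
    ext x
    simp only [mem_ofPred_eq, mem_singleton_iff, mem_Ioo]
    constructor
    · rintro ⟨⟨hx, hx1⟩, hxe⟩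
      have hx0 : 0 < x := by
        by_contra hc
        have hc := not_lt.1 hc
        have h1 : p * x / √(1 - x ^ 2) ≤ 0 :=
          div_nonpos_of_nonpos_of_nonneg (mul_nonpos_of_nonneg_of_nonpos hp.le hc) (Real.sqrt_nonneg _)
        have h2 : q * x / √(β ^ 2 - x ^ 2) ≤ 0 :=
          div_nonpos_of_nonpos_of_nonneg (mul_nonpos_of_nonneg_of_nonpos hq hc) (Real.sqrt_nonneg _)
        linarith
      rcases lt_trichotomy x s with hlt | rfl | hlt
      · have := snellSum_lt hβ hp hq hx0 hlt hs1
        linarith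
      · rfl
      · have := snellSum_lt hβ hp hq hs hlt hx1
        linarith
    · rintro rfl
      exact ⟨⟨by linarith, hs1⟩, he⟩
  rw [snellSine, this, csInf_singleton]

theorem normalizedLength_zero {β : ℝ} (hβ : 1 ≤ β) : normalizedLength 0 β = 0 := by
  have hd : darkThickness 0 = 0 := by simp [darkThickness]
  have h2 : (0 : ℝ) < √2 := by positivity
  have hsq : √(2 : ℝ) ^ 2 = 2 := Real.sq_sqrt (by norm_num)
  have e1 : √(1 - (1 / √2 : ℝ) ^ 2) = 1 / √2 := by
    rw [div_pow, hsq, Real.sqrt_eq_iff_mul_self_eq (by norm_num) (by positivity)]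
    rw [← sq, div_pow, hsq]; norm_num
  have hs : snellSine β 1 0 1 = 1 / √2 := by
    refine snellSine_eq hβ one_pos le_rfl one_pos (by positivity) ?_ ?_
    · rw [div_lt_one h2, Real.lt_sqrt] <;> norm_num
    · rw [e1]; field_simp; simp
  rw [normalizedLength, lightThickness, hd]
  simp only [zero_add, sub_zero, snellLength, hs, e1]
  simp

theorem exists_snellData {β : ℝ} (hβ : 1 ≤ β) : ∃ s c₁ c₂, SnellData β s c₁ c₂ ∧
    normalizedLength 2 β = 2 * c₁ + c₂ + s - 2 - √2 := by
  have hp1 : ∀ s ∈ Icc (0 : ℝ) (4 / 5), 0 < √(1 - s ^ 2) := fun s hs =>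
    Real.sqrt_pos.2 (by nlinarith [hs.1, hs.2])
  have hp2 : ∀ s ∈ Icc (0 : ℝ) (4 / 5), 0 < √(β ^ 2 - s ^ 2) := fun s hs =>
    Real.sqrt_pos.2 (by nlinarith [hs.1, hs.2])
  have hc : ContinuousOn (fun s : ℝ => 2 * s / √(1 - s ^ 2) + 1 * s / √(β ^ 2 - s ^ 2))
      (Icc 0 (4 / 5)) := by
    refine ContinuousOn.add (ContinuousOn.div (by fun_prop) (by fun_prop) fun s hs => (hp1 s hs).ne')
      (ContinuousOn.div (by fun_prop) (by fun_prop) fun s hs => (hp2 s hs).ne')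
  -- At s = 4/5 the light term alone is 8/3 > 1.
  obtain ⟨s, hs, he⟩ := intermediate_value_Icc (by norm_num) hc (show (1 : ℝ) ∈ Icc _ _ by
    constructor
    · simp
    · have e : √(1 - (4 / 5 : ℝ) ^ 2) = 3 / 5 := by
        rw [Real.sqrt_eq_iff_mul_self_eq] <;> norm_num
      have := hp2 (4 / 5) (by norm_num)
      have h3 : 0 ≤ 1 * (4 / 5) / √(β ^ 2 - (4 / 5) ^ 2) := by positivity
      simp only [e]
      linarith)
  simp only at he
  have hs0 : 0 < s := by
    rcases hs.1.eq_or_lt with h | h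
    · rw [← h] at he; simp at he
    · exact h
  have h1 := hp1 s hs
  have h2 := hp2 s hs
  have q1 : √(1 - s ^ 2) ^ 2 = 1 - s ^ 2 := Real.sq_sqrt (by nlinarith [hs.1, hs.2])
  have q2 : √(β ^ 2 - s ^ 2) ^ 2 = β ^ 2 - s ^ 2 := Real.sq_sqrt (by nlinarith [hs.1, hs.2])
  have hS := snellSine_eq hβ two_pos zero_le_one one_pos hs0 (by linarith [hs.2]) he
  have hd : darkThickness 2 = 1 := by
    have : ⌊(2 : ℝ)⌋ = 2 := by norm_num
    rw [darkThickness, this, if_neg (by decide)]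
    norm_num
  have hl : lightThickness 2 = 2 := by rw [lightThickness, hd]; norm_num
  refine ⟨s, √(1 - s ^ 2), √(β ^ 2 - s ^ 2), ⟨hs0, h1, h2, by linarith, by linarith, by simpa using he⟩, ?_⟩
  rw [normalizedLength, hd, hl, snellLength, hS]
  generalize √(1 - s ^ 2) = c₁ at *
  generalize √(β ^ 2 - s ^ 2) = c₂ at *
  -- Splitting off s times the Snell sum, which is 1, turns the length into 2 c₁ + c₂ + s, momentum
  -- paired with displacement.
  have e1 : 2 / c₁ = 2 * c₁ + s * (2 * s / c₁) := by
    field_simp; linear_combination (-1) * q1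
  have e2 : β ^ 2 * 1 / c₂ = c₂ + s * (1 * s / c₂) := by
    field_simp; linear_combination (-1) * q2
  rw [e1, e2]
  linear_combination s * he

/-- Optical length of the polyline `(0, 0)`, `(1, y)`, `(2, z)`, `(3, 1)`. -/
noncomputable def polyCost (β y z : ℝ) : ℝ := √(1 + y ^ 2) + β * √(1 + (z - y) ^ 2) + √(1 + (1 - z) ^ 2)

/-- Cauchy–Schwarz, as a calibration: (p, q) is a momentum admissible for the index κ. All lower
bounds for crossings come from choices of (p, q). -/
theorem le_mul_sqrt {κ p q x y : ℝ} (hκ : 0 ≤ κ) (h : p ^ 2 + q ^ 2 ≤ κ ^ 2) :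
    p * x + q * y ≤ κ * √(x ^ 2 + y ^ 2) := by
  rw [← Real.sqrt_sq hκ, ← Real.sqrt_mul (sq_nonneg _)]
  refine Real.le_sqrt_of_sq_le ?_
  have : (p ^ 2 + q ^ 2) * (x ^ 2 + y ^ 2) ≤ κ ^ 2 * (x ^ 2 + y ^ 2) := by gcongr
  nlinarith [sq_nonneg (p * y - q * x)]

theorem le_sqrt_sq_add {p q x y : ℝ} (h : p ^ 2 + q ^ 2 ≤ 1) :
    p * x + q * y ≤ √(x ^ 2 + y ^ 2) := by
  simpa using le_mul_sqrt (κ := 1) (x := x) (y := y) zero_le_one (by simpa using h)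

theorem le_sqrt_one {p q y : ℝ} (h : p ^ 2 + q ^ 2 ≤ 1) : p + q * y ≤ √(1 + y ^ 2) := by
  simpa using le_sqrt_sq_add (x := 1) (y := y) h

theorem cross_eq_of_mul_sqrt_le {κ p q x y : ℝ} (hκ : 0 ≤ κ) (h : p ^ 2 + q ^ 2 = κ ^ 2)
    (hle : κ * √(x ^ 2 + y ^ 2) ≤ p * x + q * y) : p * y = q * x := by
  have h0 : 0 ≤ κ * √(x ^ 2 + y ^ 2) := by positivity
  have h1 := pow_le_pow_left₀ h0 hle 2
  rw [mul_pow, Real.sq_sqrt (by positivity), ← h] at h1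
  have : (p * y - q * x) ^ 2 ≤ 0 := by nlinarith
  have := pow_eq_zero_iff (two_ne_zero) |>.1 (le_antisymm this (sq_nonneg _))
  linarith

namespace SnellData

variable {β s c₁ c₂ : ℝ} (h : SnellData β s c₁ c₂)
include h

/-- Calibrate each side by the Snell momentum. The vertical component s is common to the three
layers, so y and z cancel. -/
theorem le_polyCost (hβ : 0 ≤ β) (y z : ℝ) : 2 * c₁ + c₂ + s ≤ polyCost β y z := by
  have h1 := le_sqrt_one (y := y) h.light_sq.le
  have h2 := le_mul_sqrt (x := 1) (y := z - y) hβ h.dark_sq.le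
  have h3 := le_sqrt_one (y := 1 - z) h.light_sq.le
  rw [one_pow] at h2
  unfold polyCost
  linarith

theorem eq_of_polyCost_le (hβ : 0 ≤ β) {y z : ℝ} (hle : polyCost β y z ≤ 2 * c₁ + c₂ + s) :
    y = s / c₁ ∧ z = 1 - s / c₁ := by
  have h1 := le_sqrt_one (y := y) h.light_sq.le
  have h2 := le_mul_sqrt (x := 1) (y := z - y) hβ h.dark_sq.le
  have h3 := le_sqrt_one (y := 1 - z) h.light_sq.le
  rw [one_pow] at h2
  unfold polyCost at hle
  have hl : c₁ ^ 2 + s ^ 2 = 1 ^ 2 := by rw [one_pow]; exact h.light_sq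
  have k1 := cross_eq_of_mul_sqrt_le (x := 1) (y := y) zero_le_one hl (by rw [one_pow]; linarith)
  have k3 := cross_eq_of_mul_sqrt_le (x := 1) (y := 1 - z) zero_le_one hl (by rw [one_pow]; linarith)
  have := h.light_pos.ne'
  constructor
  · field_simp; linarith
  · field_simp; linarith

theorem dark_slope : 1 - s / c₁ - s / c₁ = s / c₂ := by
  have := h.snell
  rw [mul_div_assoc] at this
  linarith

theorem sqrt_one_add_light : √(1 + (s / c₁) ^ 2) = c₁ + s * (s / c₁) := by
  have := h.light_pos
  have hs := h.s_pos
  rw [Real.sqrt_eq_iff_mul_self_eq (by positivity) (by positivity)]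
  have := h.light_sq
  field_simp
  nlinarith

theorem mul_sqrt_one_add_dark (hβ : 0 ≤ β) : β * √(1 + (s / c₂) ^ 2) = c₂ + s * (s / c₂) := by
  have := h.dark_pos
  have hs := h.s_pos
  rw [← Real.sqrt_sq hβ, ← Real.sqrt_mul (sq_nonneg _),
    Real.sqrt_eq_iff_mul_self_eq (by positivity) (by positivity)]
  have := h.dark_sq
  rw [← this]
  field_simp

theorem polyCost_eq (hβ : 0 ≤ β) : polyCost β (s / c₁) (1 - s / c₁) = 2 * c₁ + c₂ + s := by
  rw [polyCost, h.dark_slope, sub_sub_cancel, h.sqrt_one_add_light, h.mul_sqrt_one_add_dark hβ]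
  have := h.snell
  rw [mul_div_assoc] at this
  linear_combination s * this

theorem slope_le : 2 * (s / c₁) ≤ 1 := by
  have := h.snell
  have h2 : 0 < s / c₂ := div_pos h.s_pos h.dark_pos
  rw [mul_div_assoc] at this
  linarith

theorem two_mul_s_le : 2 * s ≤ c₁ := by
  have := h.slope_le
  rw [← mul_div_assoc, div_le_one h.light_pos] at this
  exact this

theorem light_ge : 89 / 100 ≤ c₁ := by
  have := h.two_mul_s_le
  have := h.light_sq
  have := h.s_pos
  have := h.light_pos
  nlinarith

theorem light_lt_one : c₁ < 1 := by
  have := h.light_sq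
  have := h.s_pos
  have := h.light_pos
  nlinarith

/-- From 2s ≤ c₁ one gets s² ≤ 1/5, hence c₁² ≥ 4/5 and c₂² ≥ 3/2 - 1/5 = 1.3. -/
theorem two_lt_add (hβ : 3 / 2 ≤ β ^ 2) : 2 < c₁ + c₂ := by
  have h1 := h.light_ge
  have h2 := h.two_mul_s_le
  have h3 := h.light_sq
  have h4 := h.dark_sq
  have h5 := h.s_pos
  have h6 := h.dark_pos
  have : 113 / 100 ≤ c₂ := by nlinarith
  linarith

end SnellData

/-! ### Continuity and sign of l(2, ·) below the critical index -/

theorem polyCost_le_add {b b' y : ℝ} (h0 : 0 ≤ y) (h1 : 2 * y ≤ 1) :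
    polyCost b' y (1 - y) ≤ polyCost b y (1 - y) + 2 * |b' - b| := by
  have h2 : √(1 + (1 - y - y) ^ 2) ≤ 2 := Real.sqrt_le_iff.2 ⟨by norm_num, by nlinarith⟩
  have h3 := Real.sqrt_nonneg (1 + (1 - y - y) ^ 2)
  unfold polyCost
  nlinarith [le_abs_self (b' - b), abs_nonneg (b' - b)]

/-- The optimal polyline for b is a competitor for b', and only the factor of its dark side changes.
-/
theorem normalizedLength_two_le_add {b b' : ℝ} (hb : 1 ≤ b) (hb' : 1 ≤ b') :
    normalizedLength 2 b' ≤ normalizedLength 2 b + 2 * |b' - b| := by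
  obtain ⟨s, c₁, c₂, h, e⟩ := exists_snellData hb
  obtain ⟨s', c₁', c₂', h', e'⟩ := exists_snellData hb'
  have h1 := h'.le_polyCost (by linarith) (s / c₁) (1 - s / c₁)
  have h2 := polyCost_le_add (b := b) (b' := b') (div_pos h.s_pos h.light_pos).le h.slope_le
  rw [h.polyCost_eq (by linarith)] at h2
  linarith

theorem normalizedLength_two_lipschitz :
    LipschitzOnWith 2 (normalizedLength 2) (Ici (1 : ℝ)) := by
  refine LipschitzOnWith.of_dist_le_mul fun x hx y hy => ?_
  have h1 := normalizedLength_two_le_add hx hy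
  have h2 := normalizedLength_two_le_add hy hx
  rw [abs_sub_comm] at h1
  rw [Real.dist_eq, Real.dist_eq, abs_le]
  simp only [NNReal.coe_ofNat]
  constructor <;> linarith

theorem normalizedLength_two_sqrt_neg : normalizedLength 2 √(3 / 2) < 0 := by
  have hb : (1 : ℝ) ≤ √(3 / 2) := Real.le_sqrt_of_sq_le (by norm_num)
  obtain ⟨s, c₁, c₂, h, e⟩ := exists_snellData hb
  -- A nearly optimal test polyline: its cost is below 3.4, less than 2 + √2.
  have h1 := h.le_polyCost (by linarith) (9 / 25) (16 / 25)
  have h2 : √(1 + (9 / 25 : ℝ) ^ 2) ≤ 1.063 := Real.sqrt_le_iff.2 ⟨by norm_num, by norm_num⟩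
  have h3 : √(3 / 2 : ℝ) ≤ 1.2248 := Real.sqrt_le_iff.2 ⟨by norm_num, by norm_num⟩
  have h4 : √(1 + (16 / 25 - 9 / 25 : ℝ) ^ 2) ≤ 1.0385 := Real.sqrt_le_iff.2 ⟨by norm_num, by norm_num⟩
  have h5 : √(1 + (1 - 16 / 25 : ℝ) ^ 2) ≤ 1.063 := Real.sqrt_le_iff.2 ⟨by norm_num, by norm_num⟩
  have h6 : (1.414 : ℝ) ≤ √2 := Real.le_sqrt_of_sq_le (by norm_num)
  have h7 := mul_le_mul h3 h4 (Real.sqrt_nonneg _) (by norm_num)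
  rw [polyCost] at h1
  rw [e]
  linarith

theorem normalizedLength_two_neg {β : ℝ} (hβ : √(3 / 2) ≤ β) (hβc : β < criticalIndex 0) :
    normalizedLength 2 β < 0 := by
  have hb : (1 : ℝ) < √(3 / 2) := Real.lt_sqrt_of_sq_lt (by norm_num)
  -- For an empty set the infimum would be 0, against √(3/2) ≤ β < β^c_0.
  have hne : {b | b ∈ Ioo 1 (√2) ∧ lengthGap 0 b = 0}.Nonempty := by
    by_contra hc
    rw [criticalIndex, not_nonempty_iff_eq_empty.1 hc, Real.sInf_empty] at hβc
    linarith
  have hbdd : BddBelow {b | b ∈ Ioo 1 (√2) ∧ lengthGap 0 b = 0} := ⟨1, fun b hb => hb.1.1.le⟩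
  obtain ⟨b₀, hb₀⟩ := hne
  have hβ2 : β < √2 := hβc.trans_le ((csInf_le hbdd hb₀).trans hb₀.1.2.le)
  by_contra hc
  obtain ⟨b, hb', hb0⟩ := intermediate_value_Icc hβ
    (normalizedLength_two_lipschitz.continuousOn.mono fun x hx => hb.le.trans hx.1)
    (show (0 : ℝ) ∈ Icc _ _ from ⟨normalizedLength_two_sqrt_neg.le, not_lt.1 hc⟩)
  have hmem : b ∈ {b | b ∈ Ioo 1 (√2) ∧ lengthGap 0 b = 0} := by
    refine ⟨⟨hb.trans_le hb'.1, hb'.2.trans_lt hβ2⟩, ?_⟩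
    simp [lengthGap, normalizedLength_zero (hb.le.trans hb'.1), hb0]
  have := csInf_le hbdd hmem
  rw [criticalIndex] at hβc
  linarith [hb'.2]

/-! ### First and last passages, and passages through the grid lines -/

theorem exists_last_passage {f : ℝ → ℝ} {s t m : ℝ} (hst : s ≤ t) (hf : ContinuousOn f (Icc s t))
    (hs : f s ≤ m) (ht : m ≤ f t) : ∃ r ∈ Icc s t, f r = m ∧ ∀ x ∈ Ioc r t, m < f x := by
  have hcl : IsCompact (Icc s t ∩ f ⁻¹' {m}) :=
    isCompact_Icc.of_isClosed_subset (hf.preimage_isClosed_of_isClosed isClosed_Icc isClosed_singleton)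
      inter_subset_left
  obtain ⟨x, hx, hxe⟩ := intermediate_value_Icc hst hf ⟨hs, ht⟩
  obtain ⟨r, ⟨hr, hre⟩, hmax⟩ := hcl.exists_isGreatest ⟨x, hx, hxe⟩
  refine ⟨r, hr, hre, fun x hx => ?_⟩
  by_contra hc
  obtain ⟨y, hy, hye⟩ := intermediate_value_Icc hx.2
    (hf.mono (Icc_subset_Icc (hr.1.trans hx.1.le) le_rfl)) ⟨not_lt.1 hc, ht⟩
  have := hmax ⟨⟨hr.1.trans (hx.1.le.trans hy.1), hy.2⟩, hye⟩
  linarith [hx.1, hy.1]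

theorem exists_first_passage {f : ℝ → ℝ} {s t m : ℝ} (hst : s ≤ t) (hf : ContinuousOn f (Icc s t))
    (hs : f s ≤ m) (ht : m ≤ f t) : ∃ r ∈ Icc s t, f r = m ∧ ∀ x ∈ Ico s r, f x < m := by
  have hcl : IsCompact (Icc s t ∩ f ⁻¹' {m}) :=
    isCompact_Icc.of_isClosed_subset (hf.preimage_isClosed_of_isClosed isClosed_Icc isClosed_singleton)
      inter_subset_left
  obtain ⟨x, hx, hxe⟩ := intermediate_value_Icc hst hf ⟨hs, ht⟩
  obtain ⟨r, ⟨hr, hre⟩, hmin⟩ := hcl.exists_isLeast ⟨x, hx, hxe⟩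
  refine ⟨r, hr, hre, fun x hx => ?_⟩
  by_contra hc
  obtain ⟨y, hy, hye⟩ := intermediate_value_Icc hx.1
    (hf.mono (Icc_subset_Icc le_rfl (hx.2.le.trans hr.2))) ⟨hs, not_lt.1 hc⟩
  have := hmin ⟨⟨hy.1, hy.2.trans (hx.2.le.trans hr.2)⟩, hye⟩
  linarith [hx.2, hy.2]

theorem continuousOn_coord {u : ℝ → Plane} (hu : AbsolutelyContinuousOnInterval u 0 1) (i : Fin 2)
    {s t : ℝ} (hs : 0 ≤ s) (ht : t ≤ 1) : ContinuousOn (fun r => u r i) (Icc s t) :=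
  (lipschitz_coord i).continuous.comp_continuousOn
    ((continuousOn_of_ac hu).mono (Icc_subset_Icc hs ht))

/-- On a grid line the index has its least value 1, so a geodesic that returns to the line has
followed it. -/
theorem IsGeodesic.coord_eq {β : ℝ} (hβ : 1 ≤ β) {P Q : Plane} {u : ℝ → Plane}
    (hu : IsGeodesic (chessIndex β) P Q u) {s t : ℝ} (hs : 0 ≤ s) (ht : t ≤ 1)
    {i : Fin 2} {m : ℤ} (h1 : u s i = m) (h2 : u t i = m) : ∀ r ∈ Icc s t, u r i = m := by
  intro r hr
  have hmem : u r ∈ segment ℝ (u s) (u t) := by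
    rw [← hu.image_eq_segment (isIndex_chessIndex hβ) hs (hr.1.trans hr.2) ht fun x _ => ?_]
    · exact mem_image_of_mem u hr
    · have : AffineMap.lineMap (u s) (u t) x i = m := by rw [lineMap_coord, h1, h2]; ring
      fin_cases i
      exacts [(chessIndex_of_int_left β this).le, (chessIndex_of_int_right β this).le]
  rw [segment_eq_image_lineMap] at hmem
  obtain ⟨x, -, hx⟩ := hmem
  rw [← hx, lineMap_coord, h1, h2]
  ring

theorem IsGeodesic.le_coord {β : ℝ} (hβ : 1 ≤ β) {P Q : Plane} {u : ℝ → Plane}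
    (hu : IsGeodesic (chessIndex β) P Q u) {s t : ℝ} (hs : 0 ≤ s) (ht : t ≤ 1)
    {i : Fin 2} {m : ℤ} (h1 : m ≤ u s i) (h2 : m ≤ u t i) : ∀ r ∈ Icc s t, m ≤ u r i := by
  intro r hr
  by_contra hc
  have hc := not_le.1 hc
  obtain ⟨x, hx, hxe⟩ := intermediate_value_Icc' hr.1
    (continuousOn_coord hu.isCurve.ac i hs (hr.2.trans ht)) ⟨hc.le, h1⟩
  obtain ⟨y, hy, hye⟩ := intermediate_value_Icc hr.2
    (continuousOn_coord hu.isCurve.ac i (hs.trans hr.1) ht) ⟨hc.le, h2⟩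
  have := hu.coord_eq hβ (hs.trans hx.1) (hy.2.trans ht) hxe hye r ⟨hx.2, hy.1⟩
  linarith

theorem pt_eta (P : Plane) : pt (P 0) (P 1) = P := plane_ext rfl rfl

theorem norm_pt_sub (x y x' y' : ℝ) : ‖pt x y - pt x' y'‖ = √((x - x') ^ 2 + (y - y') ^ 2) := by
  rw [norm_sub_plane]; rfl

/-! ### Crossing the zone between two light diagonals -/

/-- The arc over `[T₀, T₁]` of a chessboard geodesic goes from the point `(a, a)` of `D_0` to the
point `(2 + b, b)` of `D_1` inside the zone between these diagonals. -/
structure Crossing (β : ℝ) (u : ℝ → Plane) (T₀ T₁ a b : ℝ) : Prop where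
  one_le : 1 ≤ β
  three_le : 3 / 2 ≤ β ^ 2
  geodesic : ∃ P Q, IsGeodesic (chessIndex β) P Q u
  start_nonneg : 0 ≤ T₀
  start_le : T₀ ≤ T₁
  end_le : T₁ ≤ 1
  start_eq : u T₀ = pt a a
  end_eq : u T₁ = pt (2 + b) b
  a_nonneg : 0 ≤ a
  a_lt : a < 1
  strip : ∀ t ∈ Ioo T₀ T₁, 0 < u t 0 - u t 1 ∧ u t 0 - u t 1 < 2
  before : ∃ t ∈ Icc 0 T₀, u t 1 = 0
  after : ∃ t ∈ Icc T₁ 1, 0 ≤ u t 1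

namespace Crossing

variable {β : ℝ} {u : ℝ → Plane} {T₀ T₁ a b : ℝ} (h : Crossing β u T₀ T₁ a b)
include h

theorem ac : AbsolutelyContinuousOnInterval u 0 1 := by
  obtain ⟨P, Q, hu⟩ := h.geodesic
  exact hu.isCurve.ac

theorem isIndex : IsIndex (chessIndex β) β := isIndex_chessIndex h.one_le

theorem coord_eq {s t : ℝ} (hs : T₀ ≤ s) (ht : t ≤ T₁)
    {i : Fin 2} {m : ℤ} (h1 : u s i = m) (h2 : u t i = m) : ∀ r ∈ Icc s t, u r i = m := by
  obtain ⟨P, Q, hu⟩ := h.geodesic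
  exact hu.coord_eq h.one_le (h.start_nonneg.trans hs) (ht.trans h.end_le) h1 h2

theorem le_coord {s t : ℝ} (hs : T₀ ≤ s) (ht : t ≤ T₁)
    {i : Fin 2} {m : ℤ} (h1 : m ≤ u s i) (h2 : m ≤ u t i) : ∀ r ∈ Icc s t, m ≤ u r i := by
  obtain ⟨P, Q, hu⟩ := h.geodesic
  exact hu.le_coord h.one_le (h.start_nonneg.trans hs) (ht.trans h.end_le) h1 h2

theorem cost_add {r s t : ℝ} (hr : T₀ ≤ r) (hrs : r ≤ s) (hst : s ≤ t) (ht : t ≤ T₁) :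
    cost (chessIndex β) u r t = cost (chessIndex β) u r s + cost (chessIndex β) u s t :=
  h.isIndex.cost_add h.ac (h.start_nonneg.trans hr) hrs hst (ht.trans h.end_le)

theorem sqrt_le_cost {s t : ℝ} (hs : T₀ ≤ s) (hst : s ≤ t) (ht : t ≤ T₁) :
    √((u t 0 - u s 0) ^ 2 + (u t 1 - u s 1) ^ 2) ≤ cost (chessIndex β) u s t := by
  rw [← norm_sub_plane]
  exact h.isIndex.norm_le_cost h.ac (h.start_nonneg.trans hs) hst (ht.trans h.end_le)

theorem dark_le_cost {s t : ℝ} (hs : T₀ ≤ s) (hst : s ≤ t) (ht : t ≤ T₁) {p q : ℤ} (hpq : Odd (p + q))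
    (hd : ∀ r ∈ Ioo s t, p < u r 0 ∧ u r 0 < p + 1 ∧ q < u r 1 ∧ u r 1 < q + 1) :
    β * √((u t 0 - u s 0) ^ 2 + (u t 1 - u s 1) ^ 2) ≤ cost (chessIndex β) u s t := by
  rw [← norm_sub_plane]
  refine h.isIndex.mul_norm_le_cost h.ac (h.start_nonneg.trans hs) hst (ht.trans h.end_le) fun r hr => ?_
  obtain ⟨h1, h2, h3, h4⟩ := hd r hr
  exact (chessIndex_of_dark β hpq h1 h2 h3 h4).ge

theorem continuousOn (i : Fin 2) {s t : ℝ} (hs : T₀ ≤ s) (ht : t ≤ T₁) :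
    ContinuousOn (fun r => u r i) (Icc s t) :=
  continuousOn_coord h.ac i (h.start_nonneg.trans hs) (ht.trans h.end_le)

theorem y_nonneg {t : ℝ} (ht : t ∈ Icc T₀ T₁) : 0 ≤ u t 1 := by
  obtain ⟨P, Q, hu⟩ := h.geodesic
  obtain ⟨r, hr, hr0⟩ := h.before
  obtain ⟨r', hr', hr0'⟩ := h.after
  simpa using hu.le_coord h.one_le hr.1 hr'.2 (i := 1) (m := 0) (by simp [hr0]) (by simpa using hr0') t
    ⟨hr.2.trans ht.1, ht.2.trans hr'.1⟩

theorem b_nonneg : 0 ≤ b := by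
  simpa [h.end_eq] using h.y_nonneg ⟨h.start_le, le_rfl⟩

theorem y_eq_zero {t : ℝ} (ht : t ∈ Icc T₀ T₁) (h0 : u t 1 = 0) : ∀ r ∈ Icc T₀ t, u r 1 = 0 := by
  obtain ⟨P, Q, hu⟩ := h.geodesic
  obtain ⟨r', hr, hr0⟩ := h.before
  intro r hr'
  simpa using hu.coord_eq h.one_le hr.1 (ht.2.trans h.end_le) (i := 1) (m := 0) (by simp [hr0])
    (by simp [h0]) r ⟨hr.2.trans hr'.1, hr'.2⟩

theorem a_eq_zero {t : ℝ} (ht : t ∈ Icc T₀ T₁) (h0 : u t 1 = 0) : a = 0 := by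
  simpa [h.start_eq] using h.y_eq_zero ht h0 T₀ ⟨le_rfl, ht.1⟩

theorem two_le_cost (hb : b = 0) : a = 0 ∧ 2 ≤ cost (chessIndex β) u T₀ T₁ := by
  have ha := h.a_eq_zero ⟨h.start_le, le_rfl⟩ (by simp [h.end_eq, hb])
  refine ⟨ha, ?_⟩
  have := h.sqrt_le_cost le_rfl h.start_le le_rfl
  simpa [h.start_eq, h.end_eq, ha, hb] using this

end Crossing

/-- A crossing that ends at a point of positive height, with its last passage `τ₁` through `x = 1`
and its first passage `τ₂` through `x = 2`. -/
structure DarkCrossing (β : ℝ) (u : ℝ → Plane) (T₀ T₁ a b τ₁ τ₂ : ℝ) : Prop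
    extends Crossing β u T₀ T₁ a b where
  lt_one : T₀ < τ₁
  one_lt_two : τ₁ < τ₂
  two_lt : τ₂ < T₁
  x_one : u τ₁ 0 = 1
  x_two : u τ₂ 0 = 2
  between : ∀ t ∈ Ioo τ₁ τ₂, 1 < u t 0 ∧ u t 0 < 2

theorem Crossing.exists_darkCrossing {β : ℝ} {u : ℝ → Plane} {T₀ T₁ a b : ℝ}
    (h : Crossing β u T₀ T₁ a b) (hb : 0 < b) : ∃ τ₁ τ₂, DarkCrossing β u T₀ T₁ a b τ₁ τ₂ := by
  have ha := h.a_lt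
  obtain ⟨τ₁, m₁, e₁, l₁⟩ := exists_last_passage h.start_le (h.continuousOn 0 le_rfl le_rfl)
    (m := 1) (by simp [h.start_eq, ha.le]) (by simp [h.end_eq]; linarith)
  obtain ⟨τ₂, m₂, e₂, l₂⟩ := exists_first_passage m₁.2 (h.continuousOn 0 m₁.1 le_rfl)
    (m := 2) (by simp [e₁]) (by simp [h.end_eq]; linarith)
  refine ⟨τ₁, τ₂, h, lt_of_le_of_ne m₁.1 ?_, lt_of_le_of_ne m₂.1 ?_, lt_of_le_of_ne m₂.2 ?_, e₁, e₂, ?_⟩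
  · rintro rfl
    simp [h.start_eq] at e₁
    linarith
  · rintro rfl
    rw [e₁] at e₂; norm_num at e₂
  · rintro rfl
    simp [h.end_eq] at e₂
    linarith
  · exact fun t ht => ⟨l₁ t ⟨ht.1, ht.2.le.trans m₂.2⟩, l₂ t ⟨ht.1.le, ht.2⟩⟩

/-- The union of the sides of the polyline `(0, 0)`, `(1, y)`, `(2, 1 - y)`, `(3, 1)`. -/
def polyline (y : ℝ) : Set Plane :=
  segment ℝ (pt 0 0) (pt 1 y) ∪ segment ℝ (pt 1 y) (pt 2 (1 - y)) ∪ segment ℝ (pt 2 (1 - y)) (pt 3 1)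

namespace DarkCrossing

variable {β : ℝ} {u : ℝ → Plane} {T₀ T₁ a b τ₁ τ₂ : ℝ} (h : DarkCrossing β u T₀ T₁ a b τ₁ τ₂)
include h

theorem y_one_lt : u τ₁ 1 < 1 := by
  have := (h.strip τ₁ ⟨h.lt_one, h.one_lt_two.trans h.two_lt⟩).1
  rw [h.x_one] at this
  linarith

theorem light_le_cost : √((1 - a) ^ 2 + (u τ₁ 1 - a) ^ 2) ≤ cost (chessIndex β) u T₀ τ₁ := by
  have := h.sqrt_le_cost le_rfl h.lt_one.le (h.one_lt_two.trans h.two_lt).le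
  simpa [h.start_eq, h.x_one] using this

/-- After `τ₁` the arc is in the column 1 < x < 2. Either it stays inside the open dark square, or
it touches y = 0; then it has followed y = 0 since `T₀`, and x is the abscissa of its last point
there. -/
theorem dark_alternative {t : ℝ} (h1 : τ₁ < t) (h2 : t ≤ τ₂) (hy : ∀ r ∈ Ico τ₁ t, u r 1 < 1) :
    ((∀ r ∈ Ioo τ₁ t, (1 : ℤ) < u r 0 ∧ u r 0 < (1 : ℤ) + 1 ∧ (0 : ℤ) < u r 1 ∧ u r 1 < (0 : ℤ) + 1) ∧
      β * √((u t 0 - 1) ^ 2 + (u t 1 - u τ₁ 1) ^ 2) ≤ cost (chessIndex β) u τ₁ t) ∨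
    (a = 0 ∧ ∃ x, x + β * √((u t 0 - x) ^ 2 + u t 1 ^ 2) ≤ cost (chessIndex β) u T₀ t) := by
  have m1 := h.lt_one
  have m2 := h.two_lt
  by_cases hc : ∀ r ∈ Ioo τ₁ t, 0 < u r 1
  · have hd : ∀ r ∈ Ioo τ₁ t, (1 : ℤ) < u r 0 ∧ u r 0 < (1 : ℤ) + 1 ∧ (0 : ℤ) < u r 1 ∧
        u r 1 < (0 : ℤ) + 1 := by
      intro r hr
      obtain ⟨b1, b2⟩ := h.between r ⟨hr.1, hr.2.trans_le h2⟩
      norm_num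
      exact ⟨b1, by linarith, hc r hr, hy r ⟨hr.1.le, hr.2⟩⟩
    refine Or.inl ⟨hd, ?_⟩
    have := h.dark_le_cost m1.le h1.le (h2.trans m2.le) (by decide) hd
    rwa [h.x_one] at this
  · push Not at hc
    obtain ⟨r, hr, hr0⟩ := hc
    have hr1 : u r 1 = 0 := le_antisymm hr0 (h.y_nonneg ⟨by linarith [hr.1], by linarith [hr.2]⟩)
    obtain ⟨z, hz, hz0, hz1⟩ := exists_last_passage hr.2.le (h.continuousOn 1 (by linarith [hr.1]) (by linarith))
      (m := 0) hr1.le (h.y_nonneg ⟨by linarith, by linarith⟩)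
    have hz2 : τ₁ < z := hr.1.trans_le hz.1
    have ha := h.a_eq_zero (t := z) ⟨by linarith, by linarith [hz.2]⟩ hz0
    refine Or.inr ⟨ha, u z 0, ?_⟩
    have e1 := h.sqrt_le_cost le_rfl (by linarith : T₀ ≤ z) (by linarith [hz.2])
    have e2 := h.dark_le_cost (by linarith : T₀ ≤ z) hz.2 (by linarith) (p := 1) (q := 0) (by decide)
      fun x hx => by
        obtain ⟨b1, b2⟩ := h.between x ⟨by linarith [hx.1], by linarith [hx.2]⟩
        norm_num
        exact ⟨b1, by linarith, hz1 x ⟨hx.1, hx.2.le⟩, hy x ⟨by linarith [hx.1], hx.2⟩⟩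
    simp only at hz0
    simp only [hz0, sub_zero, h.start_eq, ha, pt_zero, pt_one, ne_eq, OfNat.ofNat_ne_zero, not_false_eq_true, zero_pow,
      add_zero, Real.sqrt_sq_eq_abs] at e1 e2
    rw [h.cost_add le_rfl (by linarith : T₀ ≤ z) hz.2 (by linarith)]
    linarith [le_abs_self (u z 0)]

theorem diag_sq_le : (1 : ℝ) ^ 2 + (√2 / 2) ^ 2 ≤ β ^ 2 := by
  have := h.three_le
  rw [div_pow, Real.sq_sqrt (by norm_num)]
  linarith

theorem beta_nonneg : 0 ≤ β := zero_le_one.trans h.one_le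

/-- Calibration by (√2/2, √2/2) before x = 1 and (1, √2/2) in the dark square. At height 1 the left
side is the length of the route up the diagonal to (1, 1) and then along y = 1. In the first
alternative strictness comes from `y_one_lt`: the first arc is not in the diagonal direction. -/
theorem diag_lt_cost {t : ℝ} (h1 : τ₁ < t) (h2 : t ≤ τ₂) (hy : ∀ r ∈ Ico τ₁ t, u r 1 < 1) :
    u t 0 - 1 + (1 + u t 1 - 2 * a) * (√2 / 2) < cost (chessIndex β) u T₀ t := by
  have h2pos : (0 : ℝ) < √2 := by positivity
  have hsq : √(2 : ℝ) ^ 2 = 2 := Real.sq_sqrt (by norm_num)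
  rcases h.dark_alternative h1 h2 hy with ⟨-, hd⟩ | ⟨ha, x, hx⟩
  · rw [h.cost_add le_rfl h.lt_one.le h1.le (h2.trans h.two_lt.le)]
    have e1 := le_mul_sqrt (x := u t 0 - 1) (y := u t 1 - u τ₁ 1) h.beta_nonneg h.diag_sq_le
    have e2 := h.light_le_cost
    have e3 : ((1 - a) + (u τ₁ 1 - a)) * (√2 / 2) < √((1 - a) ^ 2 + (u τ₁ 1 - a) ^ 2) := by
      apply Real.lt_sqrt_of_sq_lt
      have : 0 < (1 - u τ₁ 1) ^ 2 := by
        have := h.y_one_lt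
        positivity [sub_pos.2 this]
      rw [mul_pow, div_pow, hsq]
      nlinarith
    nlinarith
  · have e1 := le_mul_sqrt (x := u t 0 - x) (y := u t 1) h.beta_nonneg h.diag_sq_le
    have : √(2 : ℝ) < 2 := by rw [Real.sqrt_lt' (by norm_num)]; norm_num
    rw [ha]
    nlinarith

theorem x_le_two {t : ℝ} (h1 : τ₁ ≤ t) (h2 : t ≤ τ₂) : u t 0 ≤ 2 := by
  rcases h1.eq_or_lt with rfl | h1
  · rw [h.x_one]; norm_num
  rcases h2.eq_or_lt with rfl | h2
  · exact h.x_two.le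
  exact (h.between t ⟨h1, h2⟩).2.le

theorem two_le_x {t : ℝ} (h1 : τ₂ ≤ t) (h2 : t ≤ T₁) : 2 ≤ u t 0 := by
  have hb := h.b_nonneg
  have m1 := h.lt_one
  have m2 := h.one_lt_two
  simpa using h.le_coord (s := τ₂) (t := T₁) (by linarith) le_rfl (i := 0) (m := 2) (by simp [h.x_two])
    (by simpa [h.end_eq] using hb) t ⟨h1, h2⟩

theorem joins_top {x : ℝ} :
    ∃ S, Joins (chessIndex β) (pt a a) (pt x 1) S (√2 * (1 - a) + |x - 1|) := by
  refine ⟨_, Joins.mono (Joins.trans h.isIndex (Q := pt 1 1)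
    (joins_segment h.isIndex (κ := 1) fun r _ => ?_) (joins_segment h.isIndex (κ := 1) fun r _ => ?_)) ?_⟩
  · exact (chessIndex_of_mem_lightDiagonal β (k := 0) (by simp [lightDiagonal, lineMap_coord])).le
  · exact (chessIndex_of_int_right β (m := 1) (by simp [lineMap_coord])).le
  · rw [norm_pt_sub, norm_pt_sub, ← two_mul, Real.sqrt_mul zero_le_two,
      Real.sqrt_sq (by linarith [h.a_lt])]
    simp [Real.sqrt_sq_eq_abs]

/-- A first arrival at y = 1 with x ≤ 2 would be strictly longer than the route of `joins_top` to
the same point. -/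
theorem y_lt_one {t : ℝ} (h1 : τ₁ ≤ t) (h2 : t ≤ T₁) (hx : u t 0 ≤ 2) : u t 1 < 1 := by
  have m1 := h.lt_one
  have m2 := h.one_lt_two
  by_contra hc
  obtain ⟨r, hr, hr1, hrlt⟩ := exists_first_passage h1 (h.continuousOn 1 m1.le h2)
    (m := 1) h.y_one_lt.le (not_lt.1 hc)
  have hr0 : τ₁ < r := lt_of_le_of_ne hr.1 (by rintro rfl; exact absurd hr1 h.y_one_lt.ne)
  obtain ⟨S, hS⟩ := h.joins_top (x := u r 0)
  have hle : cost (chessIndex β) u T₀ r ≤ √2 * (1 - a) + |u r 0 - 1| := by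
    obtain ⟨P, Q, hu⟩ := h.geodesic
    refine hu.cost_le h.isIndex h.start_nonneg (by linarith) (by linarith [hr.2, h.end_le]) (S := S) ?_
    rw [h.start_eq, ← pt_eta (u r)]
    simp only at hr1
    rwa [hr1]
  rcases le_or_gt r τ₂ with hr2 | hr2
  · have hx1 : 1 ≤ u r 0 := by
      rcases hr2.eq_or_lt with e | e
      · rw [e, h.x_two]; norm_num
      · exact (h.between r ⟨hr0, e⟩).1.le
    have := h.diag_lt_cost hr0 hr2 hrlt
    simp only at hr1
    rw [abs_of_nonneg (by linarith)] at hle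
    rw [hr1] at this
    linarith
  -- After `τ₂` the arc can reach height 1 with x ≤ 2 only by climbing along x = 2.
  · have hxt : u t 0 = 2 := le_antisymm hx (h.two_le_x (by linarith [hr.2]) h2)
    have hxr : u r 0 = 2 := by
      simpa using h.coord_eq (s := τ₂) (t := t) (by linarith) h2 (i := 0) (m := 2) (by simp [h.x_two])
        (by simp [hxt]) r ⟨hr2.le, hr.2⟩
    have e1 := h.diag_lt_cost m2 le_rfl fun x hx => hrlt x ⟨hx.1, hx.2.trans hr2⟩
    have e2 := h.sqrt_le_cost (s := τ₂) (t := r) (by linarith) hr2.le (by linarith [hr.2])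
    rw [h.cost_add le_rfl (by linarith : T₀ ≤ τ₂) hr2.le (by linarith [hr.2])] at hle
    have e3 := hrlt τ₂ ⟨m2.le, hr2⟩
    simp only at hr1 e3
    rw [hxr, h.x_two, hr1, sub_self, zero_pow two_ne_zero, zero_add, Real.sqrt_sq (by linarith)] at e2
    rw [hxr] at hle
    rw [h.x_two] at e1
    have : √(2 : ℝ) < 2 := by rw [Real.sqrt_lt' (by norm_num)]; norm_num
    norm_num at hle
    nlinarith

theorem end_le_cost : √(b ^ 2 + (b - u τ₂ 1) ^ 2) ≤ cost (chessIndex β) u τ₂ T₁ := by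
  have := h.sqrt_le_cost (h.lt_one.trans h.one_lt_two).le h.two_lt.le le_rfl
  simpa [h.end_eq, h.x_two] using this

section SnellBounds

variable {s c₁ c₂ l : ℝ} (hS : SnellData β s c₁ c₂) (hl : l = 2 * c₁ + c₂ + s - 2 - √2)
include hS

/-- Lower bound for the first dark square, in terms of the momentum of the Snell path. -/
theorem snell_le_cost (hd : β * √((u τ₂ 0 - 1) ^ 2 + (u τ₂ 1 - u τ₁ 1) ^ 2) ≤
      cost (chessIndex β) u τ₁ τ₂) :
    c₁ * (1 - a) + c₂ + s * (u τ₂ 1 - a) ≤ cost (chessIndex β) u T₀ τ₂ := by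
  rw [h.cost_add le_rfl h.lt_one.le h.one_lt_two.le h.two_lt.le]
  have e1 := le_sqrt_sq_add (x := 1 - a) (y := u τ₁ 1 - a) hS.light_sq.le
  have e2 := h.light_le_cost
  have e3 := le_mul_sqrt (x := u τ₂ 0 - 1) (y := u τ₂ 1 - u τ₁ 1) h.beta_nonneg hS.dark_sq.le
  rw [h.x_two] at e3 hd
  linarith

omit hS in
theorem y_lt_one' {r : ℝ} (hr : r ∈ Icc τ₁ τ₂) : u r 1 < 1 :=
  h.y_lt_one hr.1 (hr.2.trans h.two_lt.le) (h.x_le_two hr.1 hr.2)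

omit hS in
theorem bottom_le_cost {x : ℝ}
    (hx : x + β * √((u τ₂ 0 - x) ^ 2 + u τ₂ 1 ^ 2) ≤ cost (chessIndex β) u T₀ τ₂) :
    2 + u τ₂ 1 * (√2 / 2) ≤ cost (chessIndex β) u T₀ τ₂ := by
  have := le_mul_sqrt (x := u τ₂ 0 - x) (y := u τ₂ 1) h.beta_nonneg h.diag_sq_le
  have := h.x_two
  linarith

omit h hS in
theorem plane_wave (x y : ℝ) : (x + y) * (√2 / 2) ≤ √(x ^ 2 + y ^ 2) := by
  have hsq : √(2 : ℝ) ^ 2 = 2 := Real.sq_sqrt (by norm_num)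
  have := le_sqrt_sq_add (p := √2 / 2) (q := √2 / 2) (x := x) (y := y) (by rw [div_pow, hsq]; norm_num)
  linarith

omit h in
-- The difference of the two sides is c₁ + c₂ - 2. It also makes √2 + l, the slope of N on x ≤ 1,
-- positive.
theorem lt_sqrt_two_add (hβ : 3 / 2 ≤ β ^ 2) (hl : l = 2 * c₁ + c₂ + s - 2 - √2) :
    c₁ + s < √2 + l := by
  have := hS.two_lt_add hβ
  linarith

include hl in
/-- A crossing that ends above the first row is too long. -/
theorem lt_cost_of_one_lt (hl0 : l < 0) (hb : 1 < b) :
    2 + √2 * (b - a) + l * min 1 (b - a) < cost (chessIndex β) u T₀ T₁ := by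
  have m1 := h.lt_one
  have m2 := h.one_lt_two
  have m3 := h.two_lt
  have ha := h.a_nonneg
  have ha1 := h.a_lt
  have hsq : √(2 : ℝ) ^ 2 = 2 := Real.sq_sqrt (by norm_num)
  have hr1 : √(2 : ℝ) ≤ 1.415 := Real.sqrt_le_iff.2 (by norm_num)
  have hr2 : (1.414 : ℝ) ≤ √2 := Real.le_sqrt_of_sq_le (by norm_num)
  have hc := hS.light_ge
  have hc1 := hS.light_lt_one
  -- The last point on y = 1 has 2 < x < 3, so the arc enters there the dark square (2, 3) × (1, 2).
  obtain ⟨σ, mσ, yσ, lσ⟩ := exists_last_passage m3.le (h.continuousOn 1 (by linarith) le_rfl)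
    (m := 1) (h.y_lt_one' ⟨m2.le, le_rfl⟩).le (by simp [h.end_eq]; linarith)
  simp only at yσ lσ
  have hσ1 : σ < T₁ := lt_of_le_of_ne mσ.2 (by rintro rfl; simp [h.end_eq] at yσ; linarith)
  have hx2 : ∀ r ∈ Icc σ T₁, 1 ≤ u r 1 → 2 < u r 0 := fun r hr hr1 => by
    by_contra hc
    have := h.y_lt_one (t := r) (by linarith [hr.1, mσ.1]) hr.2 (not_lt.1 hc)
    linarith
  have hX2 := hx2 σ ⟨le_rfl, hσ1.le⟩ yσ.ge
  have hX3 : u σ 0 < 3 := by linarith [(h.strip σ ⟨by linarith [mσ.1], hσ1⟩).2]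
  have hF : 2 + √2 + l - a * (√2 + l) - c₁ * (3 - u σ 0) ≤ cost (chessIndex β) u T₀ σ := by
    rw [h.cost_add le_rfl (by linarith : T₀ ≤ τ₂) mσ.1 mσ.2]
    have e0 := h.sqrt_le_cost (s := τ₂) (t := σ) (by linarith) mσ.1 mσ.2
    rw [h.x_two, yσ] at e0
    rcases h.dark_alternative m2 le_rfl (fun r hr => h.y_lt_one' ⟨hr.1, hr.2.le⟩) with ⟨-, hd⟩ | ⟨ha0, x, hx⟩
    · have e1 := h.snell_le_cost hS hd
      have e2 := le_sqrt_sq_add (x := u σ 0 - 2) (y := 1 - u τ₂ 1) hS.light_sq.le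
      have e3 := lt_sqrt_two_add hS h.three_le hl
      nlinarith
    · have e1 := h.bottom_le_cost hx
      have e2 := plane_wave (u σ 0 - 2) (1 - u τ₂ 1)
      rw [ha0]
      nlinarith
  -- First exit from that square, through its right side or its top.
  obtain ⟨ε, mε, hε, lε⟩ := exists_first_passage (f := fun r => max (u r 0 - 3) (u r 1 - 2)) hσ1.le
    (ContinuousOn.sup ((h.continuousOn 0 (by linarith [mσ.1]) le_rfl).sub continuousOn_const)
      ((h.continuousOn 1 (by linarith [mσ.1]) le_rfl).sub continuousOn_const)) (m := 0)
    (max_le (by linarith) (by rw [yσ]; norm_num))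
    (le_max_of_le_left (by simp [h.end_eq]; linarith))
  simp only at hε lε
  have hlt : σ < ε := lt_of_le_of_ne mε.1 (by
    rintro rfl
    rcases max_choice (u σ 0 - 3) (u σ 1 - 2) with e | e <;> rw [e] at hε <;> linarith)
  have hD := h.dark_le_cost (s := σ) (t := ε) (by linarith [mσ.1]) hlt.le mε.2 (p := 2) (q := 1) (by decide)
    fun r hr => by
      have h1 := lσ r ⟨hr.1, hr.2.le.trans mε.2⟩
      have h2 := hx2 r ⟨hr.1.le, hr.2.le.trans mε.2⟩ h1.le
      have h3 := max_lt_iff.1 (lε r ⟨hr.1.le, hr.2⟩)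
      norm_num
      exact ⟨h2, by linarith, h1, by linarith⟩
  have hR := h.sqrt_le_cost (s := ε) (t := T₁) (by linarith [mσ.1]) mε.2 le_rfl
  have hR' := plane_wave (2 + b - u ε 0) (b - u ε 1)
  rw [h.end_eq, pt_zero, pt_one] at hR
  rw [h.cost_add le_rfl (by linarith [mσ.1] : T₀ ≤ σ) mσ.2 le_rfl,
    h.cost_add (by linarith [mσ.1] : T₀ ≤ σ) mε.1 mε.2 le_rfl]
  have hmin : l * min 1 (b - a) ≤ l * (1 - a) :=
    mul_le_mul_of_nonpos_left (le_min (by linarith) (by linarith)) hl0.le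
  -- The second dark square pays for replacing the slope c₁ by √2/2 in `hF`: calibrate by (1, √2/2)
  -- for an exit at x = 3 and by (√2/2, 1) for an exit at y = 2, with c₁ < 1. After `ε` the diagonal
  -- plane wave suffices.
  have key : (c₁ - √2 / 2) * (3 - u σ 0) + (u ε 0 - u σ 0 + (u ε 1 - 1)) * (√2 / 2) <
      β * √((u ε 0 - u σ 0) ^ 2 + (u ε 1 - u σ 1) ^ 2) := by
    rw [yσ]
    rcases max_choice (u ε 0 - 3) (u ε 1 - 2) with e | e <;> rw [e] at hε
    · have h3 : u ε 0 = 3 := by linarith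
      have := le_mul_sqrt (x := u ε 0 - u σ 0) (y := u ε 1 - 1) h.beta_nonneg h.diag_sq_le
      rw [h3] at this ⊢
      nlinarith
    · have h3 : u ε 1 = 2 := by linarith
      have := le_mul_sqrt (p := √2 / 2) (q := 1) (x := u ε 0 - u σ 0) (y := u ε 1 - 1) h.beta_nonneg
        (by linarith [h.diag_sq_le])
      rw [h3] at this ⊢
      nlinarith
  nlinarith

include hl in
/-- A crossing inside one row is too long, unless it is a Snell path between light vertices. -/
theorem lt_cost_or_polyline (hl0 : l < 0) (hb : 0 < b) (hb1 : b ≤ 1) :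
    2 + √2 * (b - a) + l * min 1 (b - a) < cost (chessIndex β) u T₀ T₁ ∨
    (a = 0 ∧ b = 1 ∧ 2 + √2 + l ≤ cost (chessIndex β) u T₀ T₁ ∧
      (cost (chessIndex β) u T₀ T₁ ≤ 2 + √2 + l → u '' Icc T₀ T₁ = polyline (s / c₁))) := by
  have m1 := h.lt_one
  have m2 := h.one_lt_two
  have m3 := h.two_lt
  have ha := h.a_nonneg
  have e0 := h.end_le_cost
  have e4 := lt_sqrt_two_add hS h.three_le hl
  rw [min_eq_right (by linarith), h.cost_add le_rfl (by linarith : T₀ ≤ τ₂) m3.le le_rfl]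
  rcases h.dark_alternative m2 le_rfl (fun r hr => h.y_lt_one' ⟨hr.1, hr.2.le⟩) with ⟨hdark, hd⟩ | ⟨ha0, x, hx⟩
  · have e1 := h.snell_le_cost hS hd
    have e2 := le_sqrt_sq_add (x := b) (y := b - u τ₂ 1) hS.light_sq.le
    -- The Snell bound exceeds 2 + (√2 + l)(b - a) by (c₁ + c₂ - 2)(1 - (b - a)), which vanishes
    -- only for a = 0, b = 1.
    rcases (show b - a ≤ 1 by linarith).eq_or_lt with hba | hba
    · have ha0 : a = 0 := by linarith
      have hb0 : b = 1 := by linarith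
      refine Or.inr ⟨ha0, hb0, by rw [ha0] at e1; rw [hb0] at e0 e2; linarith, fun hle => ?_⟩
      have e3 := h.light_le_cost
      rw [h.cost_add le_rfl m1.le m2.le m3.le] at hle
      simp only [ha0, hb0, sub_zero, one_pow] at e3 e0
      have e5 : β * √(1 + (u τ₂ 1 - u τ₁ 1) ^ 2) ≤ cost (chessIndex β) u τ₁ τ₂ := by
        rw [h.x_two] at hd
        norm_num at hd
        exact hd
      have e6 := hS.le_polyCost h.beta_nonneg (u τ₁ 1) (u τ₂ 1)
      have e7 := hS.eq_of_polyCost_le h.beta_nonneg (y := u τ₁ 1) (z := u τ₂ 1)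
        (by rw [polyCost]; linarith)
      rw [polyCost] at e6
      have p0 : u T₀ = pt 0 0 := by rw [h.start_eq, ha0]
      have p1 : u τ₁ = pt 1 (s / c₁) := by rw [← pt_eta (u τ₁), h.x_one, e7.1]
      have p2 : u τ₂ = pt 2 (1 - s / c₁) := by rw [← pt_eta (u τ₂), h.x_two, e7.2]
      have p3 : u T₁ = pt 3 1 := by rw [h.end_eq, hb0]; norm_num
      have hs0 := h.start_nonneg
      have hs1 := h.end_le
      have i1 := h.isIndex.image_eq_segment h.ac (s := T₀) (t := τ₁) hs0 m1.le (by linarith) one_pos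
        (fun _ _ => h.isIndex.one_le _) (by
          rw [norm_sub_plane, p0, h.x_one]
          simp only [pt_zero, pt_one, sub_zero, one_pow]
          linarith)
      have i2 := h.isIndex.image_eq_segment h.ac (s := τ₁) (t := τ₂) (by linarith) m2.le (by linarith)
        (κ := β) (by linarith [h.one_le]) (fun r hr => by
          obtain ⟨d1, d2, d3, d4⟩ := hdark r hr
          exact (chessIndex_of_dark β (by decide) d1 d2 d3 d4).ge) (by
          rw [norm_sub_plane, h.x_one, h.x_two]
          norm_num
          linarith)
      have i3 := h.isIndex.image_eq_segment h.ac (s := τ₂) (t := T₁) (by linarith) m3.le (by linarith) one_pos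
        (fun _ _ => h.isIndex.one_le _) (by
          rw [norm_sub_plane, p3, h.x_two]
          norm_num
          linarith)
      rw [polyline, ← p0, ← p1, ← p2, ← p3, ← i1, ← i2, ← i3, ← image_union, ← image_union,
        Icc_union_Icc_eq_Icc m1.le m2.le, Icc_union_Icc_eq_Icc (by linarith) m3.le]
    · left
      nlinarith
  · left
    have e1 := h.bottom_le_cost hx
    have e2 := plane_wave b (b - u τ₂ 1)
    rw [ha0]
    nlinarith

end SnellBounds

end DarkCrossing

theorem Crossing.trichotomy {β : ℝ} {u : ℝ → Plane} {T₀ T₁ a b s c₁ c₂ l : ℝ}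
    (h : Crossing β u T₀ T₁ a b) (hS : SnellData β s c₁ c₂) (hl : l = 2 * c₁ + c₂ + s - 2 - √2)
    (hl0 : l < 0) :
    2 + √2 * (b - a) + l * min 1 (b - a) < cost (chessIndex β) u T₀ T₁ ∨
    (a = 0 ∧ b = 0 ∧ 2 ≤ cost (chessIndex β) u T₀ T₁) ∨
    (a = 0 ∧ b = 1 ∧ 2 + √2 + l ≤ cost (chessIndex β) u T₀ T₁ ∧
      (cost (chessIndex β) u T₀ T₁ ≤ 2 + √2 + l → u '' Icc T₀ T₁ = polyline (s / c₁))) := by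
  rcases h.b_nonneg.eq_or_lt with hb | hb
  · exact Or.inr (Or.inl ⟨(h.two_le_cost hb.symm).1, hb.symm, (h.two_le_cost hb.symm).2⟩)
  obtain ⟨τ₁, τ₂, hd⟩ := h.exists_darkCrossing hb
  rcases lt_or_ge 1 b with hb1 | hb1
  · exact Or.inl (hd.lt_cost_of_one_lt hS hl hl0 hb1)
  · rcases hd.lt_cost_or_polyline hS hl hl0 hb hb1 with h1 | h1
    · exact Or.inl h1
    · exact Or.inr (Or.inr h1)

/-! ### Snell paths in the layers, and competitors in the chessboard -/

theorem layerIndex_zero_of_mem (β : ℝ) {P : Plane} {m : ℤ} (h : (m : ℝ) ≤ P 0) (h' : P 0 < m + 1) :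
    layerIndex β 0 P = if Even m then 1 else β := by
  have e : ⌊P 0 + ((0 : ℤ) : ℝ)⌋ = m := by
    rw [Int.floor_eq_iff]
    simpa using ⟨h, h'⟩
  unfold layerIndex
  exact if_congr (by rw [e]) rfl rfl

theorem joins_polyline {a : Plane → ℝ} {β : ℝ} (ha : IsIndex a β) {y : ℝ}
    (h1 : ∀ P : Plane, 0 < P 0 → P 0 < 1 → y * P 0 = P 1 → a P ≤ 1)
    (h2 : ∀ P : Plane, 2 < P 0 → P 0 < 3 → y * (3 - P 0) = 1 - P 1 → a P ≤ 1) :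
    Joins a (pt 0 0) (pt 3 1) (polyline y) (polyCost β y (1 - y)) := by
  have j1 : Joins a (pt 0 0) (pt 1 y) _ _ := joins_segment ha (κ := 1) fun r hr => by
    apply h1 <;> simp [lineMap_coord, hr.1, hr.2, mul_comm]
  have j2 : Joins a (pt 1 y) (pt 2 (1 - y)) _ _ := joins_segment ha (κ := β) fun r _ => ha.le _
  have j3 : Joins a (pt 2 (1 - y)) (pt 3 1) _ _ := joins_segment ha (κ := 1) fun r hr => by
    apply h2 <;> simp only [lineMap_coord, pt_zero, pt_one] <;> linarith [hr.1, hr.2]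
  refine ((j1.trans ha j2).trans ha j3).mono (le_of_eq ?_)
  simp only [norm_pt_sub, polyCost]
  norm_num

namespace SnellData

variable {β s c₁ c₂ : ℝ} (h : SnellData β s c₁ c₂)
include h

theorem joins_chessIndex (hβ : 1 ≤ β) :
    Joins (chessIndex β) (pt 0 0) (pt 3 1) (polyline (s / c₁)) (2 * c₁ + c₂ + s) := by
  have hy : 0 < s / c₁ := div_pos h.s_pos h.light_pos
  have hy' := h.slope_le
  rw [← h.polyCost_eq (zero_le_one.trans hβ)]
  refine joins_polyline (isIndex_chessIndex hβ) (fun P h0 h1 hP => ?_) (fun P h0 h1 hP => ?_)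
  · refine (chessIndex_of_light β (p := 0) (q := 0) (by decide) ?_ ?_ ?_ ?_).le <;> norm_num <;> nlinarith
  · refine (chessIndex_of_light β (p := 2) (q := 0) (by decide) ?_ ?_ ?_ ?_).le <;> norm_num <;> nlinarith

theorem joins_layerIndex (hβ : 1 ≤ β) :
    Joins (layerIndex β 0) (pt 0 0) (pt 3 1) (polyline (s / c₁)) (2 * c₁ + c₂ + s) := by
  rw [← h.polyCost_eq (zero_le_one.trans hβ)]
  refine joins_polyline (isIndex_layerIndex hβ 0) (fun P h0 h1 _ => ?_) (fun P h0 h1 _ => ?_)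
  · rw [layerIndex_zero_of_mem β (m := 0) (by norm_num; linarith) (by norm_num; linarith)]
    simp
  · rw [layerIndex_zero_of_mem β (m := 2) (by norm_num; linarith) (by norm_num; linarith)]
    simp

/-- Cut at the first passage through x = 2 and the last passage through x = 1 before it: the middle
arc lies in the dark layer, so v costs at least as much as a polyline. -/
theorem le_opticalLength (hβ : 1 ≤ β) {v : ℝ → Plane} (hv : IsCurve (pt 0 0) (pt 3 1) v) :
    2 * c₁ + c₂ + s ≤ opticalLength (layerIndex β 0) v := by
  have ha := isIndex_layerIndex hβ 0
  have hac := hv.ac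
  obtain ⟨t₂, m₂, e₂, l₂⟩ := exists_first_passage zero_le_one (continuousOn_coord hac 0 le_rfl le_rfl)
    (m := 2) (by simp [hv.source]) (by simp [hv.target]; norm_num)
  obtain ⟨t₁, m₁, e₁, l₁⟩ := exists_last_passage m₂.1 (continuousOn_coord hac 0 le_rfl m₂.2)
    (m := 1) (by simp [hv.source]) (by rw [e₂]; norm_num)
  simp only at e₁ e₂
  have k1 := ha.norm_le_cost hac le_rfl m₁.1 (m₁.2.trans m₂.2)
  have k2 := ha.mul_norm_le_cost hac m₁.1 m₁.2 m₂.2 (κ := β) fun r hr => by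
    rw [layerIndex_zero_of_mem β (m := 1) (by simpa using (l₁ r ⟨hr.1, hr.2.le⟩).le)
      (by have := l₂ r ⟨m₁.1.trans hr.1.le, hr.2⟩; norm_num; linarith)]
    simp
  have k3 := ha.norm_le_cost hac m₂.1 m₂.2 le_rfl
  rw [norm_sub_plane, e₁, hv.source] at k1
  rw [norm_sub_plane, e₁, e₂] at k2
  rw [norm_sub_plane, e₂, hv.target] at k3
  have := h.le_polyCost (zero_le_one.trans hβ) (v t₁ 1) (v t₂ 1)
  change _ ≤ cost (layerIndex β 0) v 0 1
  rw [ha.cost_add hac le_rfl m₂.1 m₂.2 le_rfl, ha.cost_add hac le_rfl m₁.1 m₁.2 m₂.2]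
  norm_num at k1 k2 k3
  unfold polyCost at this
  linarith

theorem isS3Path (hβ : 1 ≤ β) (m r : ℕ) :
    IsS3Path β (pt (2 * m + r) r) (pt (2 * m + r + 3) (r + 1))
      ((· + pt (2 * m + r) r) '' polyline (s / c₁)) := by
  obtain ⟨w, hw, himg, hle⟩ := h.joins_layerIndex hβ
  have hgeo : IsGeodesic (layerIndex β 0) (pt 0 0) (pt 3 1) w :=
    ⟨hw, fun v hv => hle.trans (h.le_opticalLength hβ hv)⟩
  have ht := hgeo.translate (a := layerIndex β r) (w := pt ((2 * m + r : ℤ) : ℝ) (r : ℤ))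
    (fun P => layerIndex_add β ⟨m + r, by ring⟩ P)
  refine ⟨m, r, rfl, rfl, fun t => w t + pt ((2 * m + r : ℤ) : ℝ) (r : ℤ), ?_, ?_⟩
  · convert ht using 1
    · apply plane_ext <;> simp
    · apply plane_ext <;> simp <;> ring
  · rw [← himg, image_image]
    simp

/-- The shift (3m, m) has even coordinate sum, so it preserves the chessboard and S₃-paths can be
chained. -/
theorem joins_iterate (hβ : 1 ≤ β) (m : ℕ) :
    ∃ S, Joins (chessIndex β) (pt 0 0) (pt (3 * m) m) S (m * (2 * c₁ + c₂ + s)) := by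
  induction m with
  | zero =>
    refine ⟨_, (joins_segment (isIndex_chessIndex hβ) (κ := 1) fun r _ => ?_).mono (le_of_eq ?_)⟩
    · exact (chessIndex_of_int_left β (m := 0) (by simp)).le
    · simp
  | succ m ih =>
    obtain ⟨S, hS⟩ := ih
    have ht := (h.joins_chessIndex hβ).translate (a := chessIndex β) (w := pt ((3 * m : ℤ) : ℝ) (m : ℤ))
      (fun P => chessIndex_add β ⟨2 * m, by ring⟩ P)
    have e1 : pt 0 0 + pt ((3 * m : ℤ) : ℝ) (m : ℤ) = pt (3 * m) m := by apply plane_ext <;> simp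
    have e2 : pt 3 1 + pt ((3 * m : ℤ) : ℝ) (m : ℤ) = pt (3 * (m + 1 : ℕ)) (m + 1 : ℕ) := by
      apply plane_ext <;> simp <;> ring
    rw [e1, e2] at ht
    refine ⟨_, (hS.trans (isIndex_chessIndex hβ) ht).mono (le_of_eq ?_)⟩
    push_cast
    ring

theorem exists_joins_of_le (hβ : 1 ≤ β) {n j : ℕ} (hnj : n ≤ j) :
    ∃ S, Joins (chessIndex β) (pt 0 0) (pt (2 * n + j) j) S
      (n * (2 * c₁ + c₂ + s) + √2 * (j - n)) := by
  obtain ⟨S, hS⟩ := h.joins_iterate hβ n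
  have hnj' : (n : ℝ) ≤ j := by exact_mod_cast hnj
  refine ⟨_, (hS.trans (isIndex_chessIndex hβ)
    (joins_segment (isIndex_chessIndex hβ) (κ := 1) fun r _ => ?_)).mono (le_of_eq ?_)⟩
  · refine (chessIndex_of_mem_lightDiagonal β (k := n) ?_).le
    simp only [lightDiagonal, mem_ofPred_eq, lineMap_coord, pt_zero, pt_one, Int.cast_natCast]
    ring
  · rw [norm_pt_sub, show (2 * n + j - 3 * n : ℝ) = j - n by ring, ← two_mul,
      Real.sqrt_mul zero_le_two, Real.sqrt_sq (by linarith), one_mul]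

theorem exists_joins_of_ge (hβ : 1 ≤ β) {n j : ℕ} (hnj : j ≤ n) :
    ∃ S, Joins (chessIndex β) (pt 0 0) (pt (2 * n + j) j) S
      (j * (2 * c₁ + c₂ + s) + 2 * (n - j)) := by
  obtain ⟨S, hS⟩ := h.joins_iterate hβ j
  have hnj' : (j : ℝ) ≤ n := by exact_mod_cast hnj
  refine ⟨_, (hS.trans (isIndex_chessIndex hβ)
    (joins_segment (isIndex_chessIndex hβ) (κ := 1) fun r _ => ?_)).mono (le_of_eq ?_)⟩
  · exact (chessIndex_of_int_right β (m := j) (by simp [lineMap_coord])).le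
  · rw [norm_pt_sub, show (2 * n + j - 3 * j : ℝ) = 2 * (n - j) by ring, sub_self, zero_pow two_ne_zero,
      add_zero, Real.sqrt_sq (by linarith), one_mul]

end SnellData

/-! ### Passages of a geodesic through the light diagonals -/

/-- A chessboard geodesic from the origin to the light vertex `(2n + j, j)`. -/
structure LightGeodesic (β : ℝ) (n j : ℕ) (u : ℝ → Plane) : Prop where
  one_le : 1 ≤ β
  geodesic : IsGeodesic (chessIndex β) (pt 0 0) (pt (2 * n + j) j) u

namespace LightGeodesic

variable {β : ℝ} {n j : ℕ} {u : ℝ → Plane} (h : LightGeodesic β n j u)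
include h

theorem ac : AbsolutelyContinuousOnInterval u 0 1 := h.geodesic.isCurve.ac

theorem isIndex : IsIndex (chessIndex β) β := isIndex_chessIndex h.one_le

theorem continuousOn_diag : ContinuousOn (fun t => u t 0 - u t 1) (Icc 0 1) :=
  (continuousOn_coord h.ac 0 le_rfl le_rfl).sub (continuousOn_coord h.ac 1 le_rfl le_rfl)

omit h in
theorem mem_lightDiagonal_iff {P : Plane} {k : ℤ} : P ∈ lightDiagonal k ↔ P 0 - P 1 = 2 * k := by
  change P 1 = P 0 - 2 * k ↔ _
  constructor <;> intro <;> linarith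

theorem isCompact_passages (k : ℤ) : IsCompact {t | t ∈ Icc (0 : ℝ) 1 ∧ u t ∈ lightDiagonal k} := by
  have : {t | t ∈ Icc (0 : ℝ) 1 ∧ u t ∈ lightDiagonal k} =
      Icc 0 1 ∩ (fun t => u t 0 - u t 1) ⁻¹' {2 * (k : ℝ)} := by
    ext t
    simp [mem_lightDiagonal_iff]
  rw [this]
  exact isCompact_Icc.of_isClosed_subset
    (h.continuousOn_diag.preimage_isClosed_of_isClosed isClosed_Icc isClosed_singleton) inter_subset_left

theorem exists_passage_before {k : ℤ} (hk : 0 ≤ k) {t : ℝ} (ht : t ∈ Icc (0 : ℝ) 1)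
    (hle : 2 * (k : ℝ) ≤ u t 0 - u t 1) : ∃ r ∈ Icc 0 t, u r ∈ lightDiagonal k := by
  have hk' : (0 : ℝ) ≤ k := by exact_mod_cast hk
  obtain ⟨r, hr, hre⟩ := intermediate_value_Icc ht.1
    (h.continuousOn_diag.mono (Icc_subset_Icc le_rfl ht.2))
    ⟨by simpa [h.geodesic.isCurve.source] using hk', hle⟩
  exact ⟨r, hr, mem_lightDiagonal_iff.2 hre⟩

theorem exists_passage_after {k : ℤ} (hk : k ≤ n) {t : ℝ} (ht : t ∈ Icc (0 : ℝ) 1)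
    (hle : u t 0 - u t 1 ≤ 2 * (k : ℝ)) : ∃ r ∈ Icc t 1, u r ∈ lightDiagonal k := by
  have hk' : (k : ℝ) ≤ n := by exact_mod_cast hk
  obtain ⟨r, hr, hre⟩ := intermediate_value_Icc ht.2
    (h.continuousOn_diag.mono (Icc_subset_Icc ht.1 le_rfl))
    ⟨hle, by simpa [h.geodesic.isCurve.target] using hk'⟩
  exact ⟨r, hr, mem_lightDiagonal_iff.2 hre⟩

theorem passages_nonempty {k : ℤ} (hk : 0 ≤ k) (hk' : k ≤ n) :
    {t | t ∈ Icc (0 : ℝ) 1 ∧ u t ∈ lightDiagonal k}.Nonempty := by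
  have hk0 : (0 : ℝ) ≤ k := by exact_mod_cast hk
  obtain ⟨r, hr, hr'⟩ := h.exists_passage_after hk' (t := 0) (by simp)
    (by simpa [h.geodesic.isCurve.source] using hk0)
  exact ⟨r, hr, hr'⟩

theorem isLeast_entryTime {k : ℤ} (hk : 0 ≤ k) (hk' : k ≤ n) :
    IsLeast {t | t ∈ Icc (0 : ℝ) 1 ∧ u t ∈ lightDiagonal k} (entryTime u k) :=
  (h.isCompact_passages k).isLeast_sInf (h.passages_nonempty hk hk')

theorem isGreatest_exitTime {k : ℤ} (hk : 0 ≤ k) (hk' : k ≤ n) :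
    IsGreatest {t | t ∈ Icc (0 : ℝ) 1 ∧ u t ∈ lightDiagonal k} (exitTime u k) :=
  (h.isCompact_passages k).isGreatest_sSup (h.passages_nonempty hk hk')

theorem entryTime_le_exitTime {k : ℤ} (hk : 0 ≤ k) (hk' : k ≤ n) : entryTime u k ≤ exitTime u k :=
  (h.isLeast_entryTime hk hk').2 (h.isGreatest_exitTime hk hk').1

theorem image_of_mem_lightDiagonal {k : ℤ} {s t : ℝ} (hs : 0 ≤ s) (hst : s ≤ t) (ht : t ≤ 1)
    (h1 : u s ∈ lightDiagonal k) (h2 : u t ∈ lightDiagonal k) :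
    u '' Icc s t = segment ℝ (u s) (u t) ∧ ∀ r ∈ Icc s t, u r ∈ lightDiagonal k := by
  have hline : ∀ x : ℝ, AffineMap.lineMap (u s) (u t) x ∈ lightDiagonal k := fun x => by
    rw [mem_lightDiagonal_iff] at *
    rw [lineMap_coord, lineMap_coord]
    linear_combination (1 - x) * h1 + x * h2
  have himg := h.geodesic.image_eq_segment h.isIndex hs hst ht fun x _ =>
    (chessIndex_of_mem_lightDiagonal β (hline x)).le
  refine ⟨himg, fun r hr => ?_⟩
  have hmem : u r ∈ segment ℝ (u s) (u t) := himg ▸ mem_image_of_mem u hr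
  rw [segment_eq_image_lineMap] at hmem
  obtain ⟨x, -, hx⟩ := hmem
  exact hx ▸ hline x

theorem image_inter_lightDiagonal {k : ℤ} (hk : 0 ≤ k) (hk' : k ≤ n) :
    u '' Icc 0 1 ∩ lightDiagonal k = segment ℝ (entryPoint u k) (exitPoint u k) := by
  have he := h.isLeast_entryTime hk hk'
  have hx := h.isGreatest_exitTime hk hk'
  obtain ⟨himg, hmem⟩ := h.image_of_mem_lightDiagonal he.1.1.1 (h.entryTime_le_exitTime hk hk') hx.1.1.2
    he.1.2 hx.1.2
  rw [entryPoint, exitPoint, ← himg]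
  ext P
  constructor
  · rintro ⟨⟨t, ht, rfl⟩, hP⟩
    exact ⟨t, ⟨he.2 ⟨ht, hP⟩, hx.2 ⟨ht, hP⟩⟩, rfl⟩
  · rintro ⟨t, ht, rfl⟩
    exact ⟨⟨t, ⟨he.1.1.1.trans ht.1, ht.2.trans hx.1.1.2⟩, rfl⟩, hmem t ht⟩

/-- Otherwise the entry on D_{k+1} would lie between two passages through D_k, where the curve stays
on D_k. -/
theorem exitTime_le_entryTime {k : ℤ} (hk : 0 ≤ k) (hk' : k < n) :
    exitTime u k ≤ entryTime u (k + 1) := by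
  have he := h.isLeast_entryTime hk hk'.le
  have hx := h.isGreatest_exitTime hk hk'.le
  have he' := h.isLeast_entryTime (k := k + 1) (by omega) (by omega)
  have h1 := mem_lightDiagonal_iff.1 he'.1.2
  push_cast at h1
  by_contra hc
  obtain ⟨r, hr, hr'⟩ := h.exists_passage_before hk he'.1.1 (by linarith)
  have h2 := he.2 ⟨⟨hr.1, hr.2.trans he'.1.1.2⟩, hr'⟩
  have h3 := mem_lightDiagonal_iff.1 ((h.image_of_mem_lightDiagonal he.1.1.1
    (h.entryTime_le_exitTime hk hk'.le) hx.1.1.2 he.1.2 hx.1.2).2 _ ⟨h2.trans hr.2, (not_le.1 hc).le⟩)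
  linarith

theorem strip {k : ℤ} (hk : 0 ≤ k) (hk' : k < n) {t : ℝ}
    (ht : t ∈ Ioo (exitTime u k) (entryTime u (k + 1))) :
    2 * (k : ℝ) < u t 0 - u t 1 ∧ u t 0 - u t 1 < 2 * k + 2 := by
  have hx := h.isGreatest_exitTime hk hk'.le
  have he := h.isLeast_entryTime (k := k + 1) (by omega) (by omega)
  have ht' : t ∈ Icc (0 : ℝ) 1 := ⟨hx.1.1.1.trans ht.1.le, ht.2.le.trans he.1.1.2⟩
  constructor
  · by_contra hc
    obtain ⟨r, hr, hr'⟩ := h.exists_passage_after hk'.le ht' (not_lt.1 hc)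
    have := hx.2 ⟨⟨ht'.1.trans hr.1, hr.2⟩, hr'⟩
    linarith [ht.1, hr.1]
  · by_contra hc
    obtain ⟨r, hr, hr'⟩ := h.exists_passage_before (k := k + 1) (by omega) ht' (by push_cast; linarith)
    have := he.2 ⟨⟨hr.1, hr.2.trans ht'.2⟩, hr'⟩
    linarith [ht.2, hr.2]

theorem height_mem {t : ℝ} (ht : t ∈ Icc (0 : ℝ) 1) : 0 ≤ u t 1 ∧ u t 1 ≤ j := by
  have hj : (0 : ℝ) ≤ j := j.cast_nonneg
  constructor
  · simpa using h.geodesic.le_coord h.one_le le_rfl le_rfl (i := 1) (m := 0)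
      (by simp [h.geodesic.isCurve.source]) (by simp [h.geodesic.isCurve.target]) t ht
  · by_contra hc
    obtain ⟨r, hr, hre⟩ := intermediate_value_Icc ht.1 (continuousOn_coord h.ac 1 le_rfl ht.2)
      (show (j : ℝ) ∈ Icc _ _ from ⟨by simp [h.geodesic.isCurve.source], (not_le.1 hc).le⟩)
    have := h.geodesic.coord_eq h.one_le hr.1 le_rfl (i := 1) (m := j) (by simpa using hre)
      (by simp [h.geodesic.isCurve.target]) t ⟨hr.2, ht.2⟩
    simp only [Int.cast_natCast] at this
    linarith

theorem crossing (hβ : 3 / 2 ≤ β ^ 2) {k : ℤ} (hk : 0 ≤ k) (hk' : k < n) {i : ℤ}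
    (hi : i = ⌊u (exitTime u k) 1⌋) :
    Crossing β (fun t => u t + pt ((-(2 * k + i) : ℤ) : ℝ) ((-i : ℤ) : ℝ)) (exitTime u k)
      (entryTime u (k + 1)) (u (exitTime u k) 1 - i) (u (entryTime u (k + 1)) 1 - i) := by
  have hx := h.isGreatest_exitTime hk hk'.le
  have he := h.isLeast_entryTime (k := k + 1) (by omega) (by omega)
  have hx1 := mem_lightDiagonal_iff.1 hx.1.2
  have he1 := mem_lightDiagonal_iff.1 he.1.2
  have hh := h.height_mem hx.1.1
  have hi1 : (i : ℝ) ≤ u (exitTime u k) 1 := hi ▸ Int.floor_le _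
  have hi2 : u (exitTime u k) 1 < i + 1 := hi ▸ Int.lt_floor_add_one _
  have hi0 : (0 : ℝ) ≤ i := by
    have : 0 ≤ i := hi ▸ Int.floor_nonneg.2 hh.1
    exact_mod_cast this
  -- Shift by -(2k + i, i), of even coordinate sum: D_k becomes D_0 and the exit height falls in [0,
  -- 1).
  refine ⟨h.one_le, hβ, ⟨_, _, h.geodesic.translate fun P => chessIndex_add β ⟨-(k + i), by ring⟩ P⟩,
    hx.1.1.1, h.exitTime_le_entryTime hk hk', he.1.1.2, ?_, ?_, by linarith, by linarith, ?_, ?_, ?_⟩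
  · apply plane_ext <;> simp <;> linarith
  · push_cast at he1
    apply plane_ext <;> simp <;> linarith
  · intro t ht
    have := h.strip hk hk' ht
    simp only [PiLp.add_apply, pt_zero, pt_one, Int.cast_neg, Int.cast_add, Int.cast_mul, Int.cast_ofNat]
    constructor <;> linarith
  · obtain ⟨r, hr, hre⟩ := intermediate_value_Icc hx.1.1.1 (continuousOn_coord h.ac 1 le_rfl hx.1.1.2)
      (show (i : ℝ) ∈ Icc _ _ from ⟨by simpa [h.geodesic.isCurve.source] using hi0, hi1⟩)
    refine ⟨r, hr, ?_⟩
    simp only at hre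
    simp [hre]
  · refine ⟨1, ⟨he.1.1.2, le_rfl⟩, ?_⟩
    simp only [PiLp.add_apply, pt_one, Int.cast_neg, h.geodesic.isCurve.target]
    linarith [hh.2]

/-- The trichotomy for the passage from `D_k` to `D_{k+1}`. -/
theorem crossing_trichotomy (hβ : 3 / 2 ≤ β ^ 2) {s c₁ c₂ l : ℝ} (hS : SnellData β s c₁ c₂)
    (hl : l = 2 * c₁ + c₂ + s - 2 - √2) (hl0 : l < 0) {k : ℕ} (hk : k < n) :
    2 + √2 * (entryPoint u (k + 1) 1 - exitPoint u k 1) +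
        l * min 1 (entryPoint u (k + 1) 1 - exitPoint u k 1) <
      cost (chessIndex β) u (exitTime u k) (entryTime u (k + 1)) ∨
    ∃ r : ℕ, exitPoint u k 1 = r ∧
      (entryPoint u (k + 1) 1 = r ∧
        2 ≤ cost (chessIndex β) u (exitTime u k) (entryTime u (k + 1)) ∨
      entryPoint u (k + 1) 1 = (r + 1 : ℕ) ∧
        2 + √2 + l ≤ cost (chessIndex β) u (exitTime u k) (entryTime u (k + 1)) ∧
        (cost (chessIndex β) u (exitTime u k) (entryTime u (k + 1)) ≤ 2 + √2 + l →
          IsS3Path β (exitPoint u k) (entryPoint u (k + 1))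
            (u '' Icc (exitTime u k) (entryTime u (k + 1))))) := by
  have hk0 : (0 : ℤ) ≤ k := by positivity
  have hkn : (k : ℤ) < n := by exact_mod_cast hk
  have hx := h.isGreatest_exitTime hk0 hkn.le
  have he := h.isLeast_entryTime (k := k + 1) (by omega) (by omega)
  have hx1 := mem_lightDiagonal_iff.1 hx.1.2
  have he1 := mem_lightDiagonal_iff.1 he.1.2
  push_cast at hx1 he1
  obtain ⟨r, hr⟩ := Int.eq_ofNat_of_zero_le (Int.floor_nonneg.2 (h.height_mem hx.1.1).1)
  have hc := h.crossing hβ hk0 hkn hr.symm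
  have hcost : cost (chessIndex β) (fun t => u t + pt ((-(2 * k + r) : ℤ) : ℝ) ((-r : ℤ) : ℝ))
      (exitTime u k) (entryTime u (k + 1)) =
      cost (chessIndex β) u (exitTime u k) (entryTime u (k + 1)) := by
    simp only [cost, deriv_add_const, chessIndex_add β (show Even (-(2 * (k : ℤ) + r) + -r) from ⟨-(k + r), by ring⟩)]
  have ht := hc.trichotomy hS hl hl0
  rw [hcost] at ht
  rw [exitPoint, entryPoint]
  rcases ht with h1 | ⟨ha, hb, h1⟩ | ⟨ha, hb, h1, h2⟩
  · rw [sub_sub_sub_cancel_right] at h1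
    exact Or.inl h1
  · refine Or.inr ⟨r, by simpa using sub_eq_zero.1 ha, Or.inl ⟨by simpa using sub_eq_zero.1 hb, h1⟩⟩
  · have ha' : u (exitTime u k) 1 = r := by simpa using sub_eq_zero.1 ha
    have hb' : u (entryTime u (k + 1)) 1 = r + 1 := by
      rw [sub_eq_iff_eq_add] at hb
      rw [hb, add_comm]
      simp
    refine Or.inr ⟨r, ha', Or.inr ⟨by rw [hb']; simp, h1, fun hle => ?_⟩⟩
    have := hS.isS3Path h.one_le k r
    rw [← h2 hle, image_image] at this
    convert this using 1
    · apply plane_ext <;> simp <;> linarith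
    · apply plane_ext <;> simp <;> linarith
    · refine image_congr fun t _ => ?_
      apply plane_ext
      · simp; ring
      · simp

/-! ### Summing the costs along the geodesic -/

theorem diag_le_cost {k : ℤ} (hk : 0 ≤ k) (hk' : k ≤ n) :
    √2 * |exitPoint u k 1 - entryPoint u k 1| ≤
      cost (chessIndex β) u (entryTime u k) (exitTime u k) := by
  have he := h.isLeast_entryTime hk hk'
  have hx := h.isGreatest_exitTime hk hk'
  have he1 := mem_lightDiagonal_iff.1 he.1.2
  have hx1 := mem_lightDiagonal_iff.1 hx.1.2
  have := h.isIndex.norm_le_cost h.ac he.1.1.1 (h.entryTime_le_exitTime hk hk') hx.1.1.2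
  rwa [norm_sub_plane, show u (exitTime u k) 0 - u (entryTime u k) 0 =
    u (exitTime u k) 1 - u (entryTime u k) 1 by linarith, ← two_mul, Real.sqrt_mul zero_le_two,
    Real.sqrt_sq_eq_abs] at this

theorem entryTime_zero : entryTime u 0 = 0 :=
  le_antisymm ((h.isLeast_entryTime le_rfl (by positivity)).2 ⟨by simp, by
    simp [h.geodesic.isCurve.source, lightDiagonal]⟩)
    (h.isLeast_entryTime le_rfl (by positivity)).1.1.1

theorem exitTime_last : exitTime u n = 1 :=
  le_antisymm (h.isGreatest_exitTime (k := n) (by positivity) le_rfl).1.1.2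
    ((h.isGreatest_exitTime (k := n) (by positivity) le_rfl).2 ⟨by simp, by
    simp [h.geodesic.isCurve.target, lightDiagonal]⟩)

/-- If `α`, `γ` bound the length of all crossings and the length of `u` reaches the resulting
bound, then the passages along and between the diagonals are optimal. -/
theorem slack_nonpos {α γ : ℝ}
    (hcross : ∀ k : ℕ, k < n → α + γ * (entryPoint u (k + 1) 1 - exitPoint u k 1) ≤
      cost (chessIndex β) u (exitTime u k) (entryTime u (k + 1)))
    (hdiag : ∀ k : ℕ, k ≤ n → γ * (exitPoint u k 1 - entryPoint u k 1) ≤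
      cost (chessIndex β) u (entryTime u k) (exitTime u k))
    (hle : cost (chessIndex β) u 0 1 ≤ α * n + γ * j) :
    (∀ k : ℕ, k < n → cost (chessIndex β) u (exitTime u k) (entryTime u (k + 1)) ≤
      α + γ * (entryPoint u (k + 1) 1 - exitPoint u k 1)) ∧
    ∀ k : ℕ, k ≤ n → cost (chessIndex β) u (entryTime u k) (exitTime u k) ≤
      γ * (exitPoint u k 1 - entryPoint u k 1) := by
  set f : ℕ → ℝ := fun k => cost (chessIndex β) u (exitTime u k) (entryTime u (k + 1)) -
    (α + γ * (entryPoint u (k + 1) 1 - exitPoint u k 1)) with hf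
  set g : ℕ → ℝ := fun k => cost (chessIndex β) u (entryTime u k) (exitTime u k) -
    γ * (exitPoint u k 1 - entryPoint u k 1) with hg
  -- Costs add up and rises telescope; the slack g of D_n is left out and added in `htot`.
  have hsum : ∀ k : ℕ, k ≤ n → ∑ i ∈ Finset.range k, (f i + g i) =
      cost (chessIndex β) u 0 (entryTime u k) - α * k - γ * entryPoint u k 1 := by
    intro k
    induction k with
    | zero =>
      intro _
      simp [h.entryTime_zero, cost, entryPoint, h.geodesic.isCurve.source]
    | succ k ih =>
      intro hk
      have hkn : (k : ℤ) < n := by exact_mod_cast hk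
      have he := h.isLeast_entryTime (k := k) (by positivity) hkn.le
      have hx := h.isGreatest_exitTime (k := k) (by positivity) hkn.le
      have he' := h.isLeast_entryTime (k := k + 1) (by positivity) (by omega)
      have hxe := h.exitTime_le_entryTime (k := k) (by positivity) hkn
      have hex := h.entryTime_le_exitTime (k := k) (by positivity) hkn.le
      rw [Finset.sum_range_succ, ih (by omega)]
      push_cast
      rw [h.isIndex.cost_add h.ac le_rfl (he.1.1.1.trans hex) hxe he'.1.1.2,
        h.isIndex.cost_add h.ac le_rfl he.1.1.1 hex hx.1.1.2]
      simp only [hf, hg]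
      ring
  have hfn : ∀ i ∈ Finset.range n, 0 ≤ f i + g i := fun i hi => by
    have hi := Finset.mem_range.1 hi
    have h1 := hcross i hi
    have h2 := hdiag i hi.le
    simp only [hf, hg]
    linarith
  have hgn : 0 ≤ g n := by
    have := hdiag n le_rfl
    simp only [hg]
    linarith
  have htot : ∑ i ∈ Finset.range n, (f i + g i) + g n ≤ 0 := by
    have he := h.isLeast_entryTime (k := n) (by positivity) le_rfl
    rw [hsum n le_rfl]
    simp only [hg]
    rw [h.isIndex.cost_add h.ac le_rfl he.1.1.1 he.1.1.2 le_rfl] at hle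
    have : exitPoint u n 1 = j := by simp [exitPoint, h.exitTime_last, h.geodesic.isCurve.target]
    rw [this, h.exitTime_last]
    linarith
  have hzero := (Finset.sum_eq_zero_iff_of_nonneg hfn).1
    (le_antisymm (by linarith) (Finset.sum_nonneg hfn))
  have hsn := Finset.sum_nonneg hfn
  constructor
  · intro k hk
    have h1 := hzero k (Finset.mem_range.2 hk)
    have h2 := hdiag k hk.le
    simp only [hf, hg] at h1
    linarith
  · intro k hk
    rcases hk.eq_or_lt with rfl | hk
    · simp only [hg] at htot hsn
      linarith
    · have h1 := hzero k (Finset.mem_range.2 hk)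
      have h2 := hcross k hk
      simp only [hf, hg] at h1
      linarith

/-- `hN` makes α + γ x a minorant of N, so zero slack rules out the strict alternative. On D_k zero
slack gives √2 |Δy| ≤ γ Δy, and γ > 0 yields Δy ≥ 0. -/
theorem structure_of_bound (hβ : 3 / 2 ≤ β ^ 2) {s c₁ c₂ l : ℝ} (hS : SnellData β s c₁ c₂)
    (hl : l = 2 * c₁ + c₂ + s - 2 - √2) (hl0 : l < 0) {α γ : ℝ} (hα : α ≤ 2)
    (hαγ : α + γ = 2 + √2 + l) (hγ0 : 0 < γ) (hγ : γ ≤ √2)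
    (hN : ∀ x : ℝ, α + γ * x ≤ 2 + √2 * x + l * min 1 x)
    (hle : cost (chessIndex β) u 0 1 ≤ α * n + γ * j) :
    (∀ k : ℕ, k ≤ n → entryPoint u k 1 ≤ exitPoint u k 1) ∧
    ∀ k : ℕ, k < n → ∃ r : ℕ, exitPoint u k 1 = r ∧
      (entryPoint u (k + 1) 1 = r ∨ entryPoint u (k + 1) 1 = (r + 1 : ℕ) ∧
          IsS3Path β (exitPoint u k) (entryPoint u (k + 1))
            (u '' Icc (exitTime u k) (entryTime u (k + 1)))) := by
  have hd : ∀ k : ℕ, k ≤ n → γ * (exitPoint u k 1 - entryPoint u k 1) ≤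
      cost (chessIndex β) u (entryTime u k) (exitTime u k) := fun k hk => by
    refine le_trans ?_ (h.diag_le_cost (k := k) (by positivity) (by exact_mod_cast hk))
    calc γ * (exitPoint u k 1 - entryPoint u k 1) ≤ γ * |exitPoint u k 1 - entryPoint u k 1| := by
          gcongr; exact le_abs_self _
      _ ≤ _ := by gcongr
  obtain ⟨s1, s2⟩ := h.slack_nonpos (α := α) (γ := γ) (fun k hk => by
    rcases h.crossing_trichotomy hβ hS hl hl0 hk with h1 | ⟨r, hr, ⟨h1, h2⟩ | ⟨h1, h2, -⟩⟩
    · exact (hN _).trans h1.le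
    · rw [hr, h1, sub_self]; linarith
    · rw [hr, h1]; push_cast; linarith) hd hle
  refine ⟨fun k hk => ?_, fun k hk => ?_⟩
  · have h1 := s2 k hk
    have h2 := h.diag_le_cost (k := k) (by positivity) (by exact_mod_cast hk)
    have h3 : 0 ≤ √2 * |exitPoint u k 1 - entryPoint u k 1| := by positivity
    have := nonneg_of_mul_nonneg_right (h3.trans (h2.trans h1)) hγ0
    linarith
  · rcases h.crossing_trichotomy hβ hS hl hl0 hk with h1 | ⟨r, hr, ⟨h1, h2⟩ | ⟨h1, h2, h3⟩⟩
    · exact absurd ((hN _).trans_lt h1) (not_lt.2 (s1 k hk))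
    · exact ⟨r, hr, Or.inl h1⟩
    · refine ⟨r, hr, Or.inr ⟨h1, h3 ?_⟩⟩
      have := s1 k hk
      rw [hr, h1] at this
      push_cast at this
      linarith

theorem structure_of_snell (hβ : 3 / 2 ≤ β ^ 2) {s c₁ c₂ l : ℝ} (hS : SnellData β s c₁ c₂)
    (hl : l = 2 * c₁ + c₂ + s - 2 - √2) (hl0 : l < 0) :
    (∀ k : ℕ, k ≤ n → entryPoint u k 1 ≤ exitPoint u k 1) ∧
    ∀ k : ℕ, k < n → ∃ r : ℕ, exitPoint u k 1 = r ∧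
      (entryPoint u (k + 1) 1 = r ∨ entryPoint u (k + 1) 1 = (r + 1 : ℕ) ∧
          IsS3Path β (exitPoint u k) (entryPoint u (k + 1))
            (u '' Icc (exitTime u k) (entryTime u (k + 1)))) := by
  have hmin : ∀ c, (∃ S, Joins (chessIndex β) (pt 0 0) (pt (2 * n + j) j) S c) →
      cost (chessIndex β) u 0 1 ≤ c := by
    rintro c ⟨S, v, hv, -, hle⟩
    exact (h.geodesic.minimal v hv).trans hle
  have hγ := DarkCrossing.lt_sqrt_two_add hS hβ hl
  have := hS.s_pos
  have := hS.light_pos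
  -- The minorant is the branch of N that matches the competitor: slope √2 when there is height to
  -- spare, constant 2 when there are crossings to spare.
  rcases le_total n j with hnj | hnj
  · refine h.structure_of_bound hβ hS hl hl0 (α := 2 + l) (γ := √2) (by linarith) (by ring)
      (by positivity) le_rfl (fun x => ?_) ?_
    · nlinarith [min_le_left 1 x]
    · refine (hmin _ (hS.exists_joins_of_le h.one_le hnj)).trans (le_of_eq ?_)
      rw [hl]; ring
  · refine h.structure_of_bound hβ hS hl hl0 (α := 2) (γ := √2 + l) le_rfl (by ring)
      (by linarith) (by linarith) (fun x => ?_) ?_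
    · nlinarith [min_le_right 1 x]
    · refine (hmin _ (hS.exists_joins_of_ge h.one_le hnj)).trans (le_of_eq ?_)
      rw [hl]; ring

omit h in
theorem isLightVertex_of_height {P : Plane} {k : ℤ} (hP : P ∈ lightDiagonal k) {r : ℕ} (hr : P 1 = r) :
    IsLightVertex P := by
  refine ⟨⟨r + 2 * k, r, plane_ext ?_ (by simpa using hr)⟩, k, hP⟩
  have := mem_lightDiagonal_iff.1 hP
  simp
  linarith

end LightGeodesic

end Chessboard

open Chessboard

/-- Let `√(3/2) ≤ β < β^c_0` and let `u` be a geodesic of the chessboard from the origin to the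
light vertex `(2n + j, j)`, with `n, j ≥ 1`. For `k = 0, …, n` it meets the light diagonal `D_k`
in the segment `[A_k, B_k]`, whose endpoints are light vertices; and for `k = 0, …, n - 1` the part
of it from `B_k` to `A_{k+1}` is a horizontal segment or an `S₃`-path. -/
theorem theorem4p3 (β : ℝ) (hβ : √(3 / 2) ≤ β) (hβc : β < criticalIndex 0)
    (n j : ℕ) (hn : 1 ≤ n) (hj : 1 ≤ j) (u : ℝ → Plane)
    (hu : IsGeodesic (chessIndex β) (pt 0 0) (pt (2 * n + j) j) u) :
    (∀ k : ℕ, k ≤ n →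
      u '' Set.Icc 0 1 ∩ lightDiagonal k = segment ℝ (entryPoint u k) (exitPoint u k) ∧
      (entryPoint u k) 1 ≤ (exitPoint u k) 1 ∧
      IsLightVertex (entryPoint u k) ∧ IsLightVertex (exitPoint u k)) ∧
    ∀ k : ℕ, k < n →
      exitTime u k ≤ entryTime u (k + 1) ∧
      (((exitPoint u k) 1 = (entryPoint u (k + 1)) 1 ∧
          u '' Set.Icc (exitTime u k) (entryTime u (k + 1)) =
            segment ℝ (exitPoint u k) (entryPoint u (k + 1))) ∨
        IsS3Path β (exitPoint u k) (entryPoint u (k + 1))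
          (u '' Set.Icc (exitTime u k) (entryTime u (k + 1)))) := by
  have hβ1 : 1 ≤ β := (Real.le_sqrt_of_sq_le (by norm_num)).trans hβ
  have hβ2 : 3 / 2 ≤ β ^ 2 := by
    have := pow_le_pow_left₀ (Real.sqrt_nonneg _) hβ 2
    rwa [Real.sq_sqrt (by norm_num)] at this
  have h : LightGeodesic β n j u := ⟨hβ1, hu⟩
  obtain ⟨s, c₁, c₂, hS, hl⟩ := exists_snellData hβ1
  obtain ⟨hmono, hcross⟩ := h.structure_of_snell hβ2 hS hl (normalizedLength_two_neg hβ hβc)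
  refine ⟨fun k hk => ?_, fun k hk => ?_⟩
  · have hk0 : (0 : ℤ) ≤ k := by positivity
    have hkn : (k : ℤ) ≤ n := by exact_mod_cast hk
    refine ⟨h.image_inter_lightDiagonal hk0 hkn, hmono k hk, ?_, ?_⟩
    · have hmem := (h.isLeast_entryTime hk0 hkn).1.2
      -- A_0 is the origin; for the other indices the height of A_k is read off the crossing that
      -- ends there. Dually, B_n is the target and the other B_k start a crossing.
      rcases k with _ | k
      · refine LightGeodesic.isLightVertex_of_height hmem (r := 0) ?_
        simp [entryPoint, h.entryTime_zero, hu.isCurve.source]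
      · obtain ⟨r, -, h1 | ⟨h1, -⟩⟩ := hcross k (by omega)
        · exact LightGeodesic.isLightVertex_of_height hmem (r := r) (by simpa [entryPoint] using h1)
        · exact LightGeodesic.isLightVertex_of_height hmem (r := r + 1) (by simpa [entryPoint] using h1)
    · have hmem := (h.isGreatest_exitTime hk0 hkn).1.2
      rcases hk.eq_or_lt with rfl | hk
      · refine LightGeodesic.isLightVertex_of_height hmem (r := j) ?_
        simp [exitPoint, h.exitTime_last, hu.isCurve.target]
      · obtain ⟨r, hr, -⟩ := hcross k hk
        exact LightGeodesic.isLightVertex_of_height hmem hr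
  · have hk0 : (0 : ℤ) ≤ k := by positivity
    have hkn : (k : ℤ) < n := by exact_mod_cast hk
    have hle := h.exitTime_le_entryTime hk0 hkn
    refine ⟨hle, ?_⟩
    obtain ⟨r, hr, h1 | ⟨-, h1⟩⟩ := hcross k hk
    · refine Or.inl ⟨hr.trans h1.symm, ?_⟩
      refine hu.image_eq_segment h.isIndex (h.isGreatest_exitTime hk0 hkn.le).1.1.1 hle
        (h.isLeast_entryTime (k := k + 1) (by omega) (by omega)).1.1.2 fun x _ => ?_
      refine (chessIndex_of_int_right β (m := r) ?_).le
      rw [exitPoint] at hr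
      rw [entryPoint] at h1
      rw [lineMap_coord, hr, h1]
      simp
    · exact Or.inr h1
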